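/- For $n\ge 1$, an $n$-tuple $\mathbf{x}=(x_1,\dots,x_n)$ of nonnegative real numbers, extended $n$-periodically to a sequence $(x_i)_{i\in\mathbb{Z}}$, and an $n$-tuple $\mathbf{r}=(r_1,\dots,r_n)$ of positive integers, let $$S_n(\mathbf{x},\mathbf{r})=\sum_{i=1}^n \frac{x_i}{\frac{1}{r_i}\sum_{j=1}^{r_i}x_{i+j}},$$ the pair $(\mathbf{x},\mathbf{r})$ being called admissible if none of the denominators is zero. Let $$A_{n,*}=\inf_{\mathbf{r}}\,\inf_{\mathbf{x}}\,S_n(\mathbf{x},\mathbf{r}),$$ where $\mathbf{r}$ ranges over all $n$-tuples of positive integers and, for given $\mathbf{r}$, $\mathbf{x}$ ranges over all nonnegative $n$-tuples for which $(\mathbf{x},\mathbf{r})$ is admissible. Then there is a constant $A$, with numerical value $A=1.70465603718\dots$ (that is, $1.70465603718\le A<1.70465603719$), such that $$A_{n,*}=e\log n-A+O\!\left(\frac{1}{\log n}\right)\qquad\text{as } n\to\infty.$$ -/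

import Mathlib

open Filter Asymptotics

noncomputable section

namespace CyclicSum

/-- The `n`-periodic extension `(x_k)`, `k ∈ ℤ`, of an `n`-tuple `(x_1, …, x_n)`.
The component `x_i` of the tuple, `1 ≤ i ≤ n`, is stored at the index `i - 1 : Fin n`. -/
def periodicExt {n : ℕ} (x : Fin n → ℝ) (k : ℤ) : ℝ :=
  if h : 0 < n then
    x ⟨((k - 1) % (n : ℤ)).toNat, by
      have h1 := Int.emod_nonneg (k - 1) (b := (n : ℤ)) (by omega)
      have h2 := Int.emod_lt_of_pos (k - 1) (b := (n : ℤ)) (by omega)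
      omega⟩
  else 0

theorem periodicExt_apply {n : ℕ} (x : Fin n → ℝ) (i : Fin n) :
    periodicExt x ((i : ℤ) + 1) = x i := by
  have hn : 0 < n := i.pos
  have h : (((i : ℤ) + 1 - 1) % (n : ℤ)) = (i : ℤ) := by
    rw [add_sub_cancel_right]
    exact Int.emod_eq_of_lt (by omega) (by have := i.isLt; omega)
  simp only [periodicExt, hn, dite_true]
  congr 1
  ext
  change (((i : ℤ) + 1 - 1) % (n : ℤ)).toNat = (i : ℕ)
  rw [h, Int.toNat_natCast]

theorem periodicExt_periodic {n : ℕ} (x : Fin n → ℝ) :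
    Function.Periodic (periodicExt x) (n : ℤ) := by
  intro k
  have h : (k + (n : ℤ) - 1) % (n : ℤ) = (k - 1) % (n : ℤ) := by
    rw [show k + (n : ℤ) - 1 = (k - 1) + n by ring, Int.add_emod_right]
  simp only [periodicExt, h]

/-- The arithmetic mean of the terms `x_j`, `a ≤ j ≤ b`, of the periodic extension
(used for `a ≤ b` only). -/
def intervalAvg {n : ℕ} (x : Fin n → ℝ) (a b : ℤ) : ℝ :=
  (∑ j ∈ Finset.Icc a b, periodicExt x j) / ((b - a + 1 : ℤ) : ℝ)

/-- The mean of the `r_i` terms `x_{i+1}, …, x_{i+r_i}` following `x_i`, where the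
index `i : Fin n` stands for the position `i + 1` among `1, …, n`. -/
def forwardAvg {n : ℕ} (x : Fin n → ℝ) (r : Fin n → ℕ+) (i : Fin n) : ℝ :=
  intervalAvg x (((i : ℤ) + 1) + 1) (((i : ℤ) + 1) + ((r i : ℕ) : ℤ))

/-- The pair `(x, r)` is admissible: `x` is nonnegative and no denominator vanishes. -/
def Admissible {n : ℕ} (x : Fin n → ℝ) (r : Fin n → ℕ+) : Prop :=
  (∀ i, 0 ≤ x i) ∧ ∀ i, forwardAvg x r i ≠ 0

/-- The cyclic sum `S_n(x, r)`. -/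
def cyclicSum {n : ℕ} (x : Fin n → ℝ) (r : Fin n → ℕ+) : ℝ :=
  ∑ i, x i / forwardAvg x r i

/-- `A_{n, r}`, the infimum of `S_n(x, r)` over all `x` such that `(x, r)` is admissible.
(The set is nonempty, since `x = (1, …, 1)` is allowed, and bounded below by `0`.) -/
def lowerBoundFor {n : ℕ} (r : Fin n → ℕ+) : ℝ :=
  sInf {s : ℝ | ∃ x : Fin n → ℝ, Admissible x r ∧ s = cyclicSum x r}

/-- `A_{n, *}`, the infimum of `A_{n, r}` over all `n`-tuples `r` of positive integers. -/
def lowerBound (n : ℕ) : ℝ :=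
  ⨅ r : Fin n → ℕ+, lowerBoundFor r

end CyclicSum

end

/-!
The constant is the supremum `A` of the gains `e log W_m - (u_0 + ⋯ + u_{m-1})` of chains: steps
`u_k ≥ 0` and weights `W_0 = 1`, `W_{k+1} = 1 + u_k W_k`.

Lower estimate. Rotate the sequence so that all its prefix means are at most the total mean `T / n`
(cycle lemma). Then every forward mean is at most the largest term that follows before the end of
the period, and the last one is at most `T / n`. The records from the right form a chain with ratios
`u_k`; a term which is not a record costs at least its quotient by the current record, which is no
less than the cost of adding it to the first step. Hence every cyclic sum is at least
`u_0 + ⋯ + u_{m-1} + n / W_m` for some chain (`exists_chain_le_cyclicSum`). Since `e log x ≤ x`,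
this is at least `e log n - A`, without any error term.

Upper estimate. Conversely a chain of `m < n` positive steps gives a cyclic sum equal to
`u_0 + ⋯ + u_{m-1} + n / W_m` (`exists_cyclicSum_eq`). Take a chain of maximal gain with about
`(log n) / 4` steps and continue it with equal steps close to `e` until the weight is `n / e`. The
integrality of the number of steps costs `O(1 / log n)`.

Maximal chains. For a given length the maximal gain is attained, all steps are positive, and
stationarity gives `W_{k+1} = u_{k+1} W_k`, with the last weight `e` times the previous one. So the
chain is determined by `s = W_1`: with `U_k = u_{k+1}`, `V_k = W_{k+1}` one has `U_0 = V_0 = s`,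
`U_{k+1} = U_k + 1 / V_k`, `V_{k+1} = U_{k+1} V_k`, and `s` must be such that the ratios reach `e`
at the end. The weights at least double from `W_1` on, hence a maximal chain of `K + 1` steps has
gain at least `A - 2 / 2 ^ K` (`IsMaxChain.gain_le`).

Numerical value. The terminal condition has a spurious solution near `s = 1.15`, excluded because
the gain would be too small for `s ≤ 1.23` (`gain_lt_of_le`), while the ratios stay below `e` for
`1.23 ≤ s ≤ 1.7` (`orbitRatio_lt_of_mem`). For `s ≥ 1.7` the ratios increase with `s`
(`orbitRatio_mono`), so that the recursion, evaluated in fixed-point arithmetic at two points,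
confines `s` to an interval of length `2 · 10⁻¹³`; the value of the gain follows.
-/

namespace CyclicSum

/-! ### Chains and their gain -/

/-- The weight `W_m` of a chain with steps `u_0, u_1, …`: `W_0 = 1` and `W_{k+1} = 1 + u_k W_k`.
If `u_k = b_k / b_{k+1}` for positive numbers `b_k`, then `W_m = (b_0 + ⋯ + b_m) / b_m`. -/
def chainWeight (u : ℕ → ℝ) : ℕ → ℝ
  | 0 => 1
  | k + 1 => 1 + u k * chainWeight u k

/-- The gain `e log W_m - (u_0 + ⋯ + u_{m-1})` of the first `m` steps of a chain. The constant of
the theorem is the supremum of all gains of chains with nonnegative steps. -/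
noncomputable def chainGain (u : ℕ → ℝ) (m : ℕ) : ℝ :=
  Real.exp 1 * Real.log (chainWeight u m) - ∑ k ∈ Finset.range m, u k

theorem exp_one_mul_log_le {x : ℝ} (hx : 0 < x) : Real.exp 1 * Real.log x ≤ x := by
  have h := Real.add_one_le_exp (Real.log x - 1)
  rw [Real.exp_sub, Real.exp_log hx] at h
  have he := Real.exp_pos 1
  rw [le_div_iff₀ he] at h
  linarith

theorem one_le_chainWeight {u : ℕ → ℝ} (hu : ∀ k, 0 ≤ u k) (m : ℕ) : 1 ≤ chainWeight u m := by
  induction m with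
  | zero => simp [chainWeight]
  | succ k ih =>
    have := mul_nonneg (hu k) (zero_le_one.trans ih)
    simp only [chainWeight]
    linarith

theorem chainWeight_pos {u : ℕ → ℝ} (hu : ∀ k, 0 ≤ u k) (m : ℕ) : 0 < chainWeight u m :=
  zero_lt_one.trans_le (one_le_chainWeight hu m)

theorem chainWeight_congr {u v : ℕ → ℝ} {m : ℕ} (h : ∀ k < m, u k = v k) :
    chainWeight u m = chainWeight v m := by
  induction m with
  | zero => rfl
  | succ k ih =>
    simp only [chainWeight]
    rw [ih fun i hi => h i (by omega), h k (by omega)]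

theorem chainGain_congr {u v : ℕ → ℝ} {m : ℕ} (h : ∀ k < m, u k = v k) :
    chainGain u m = chainGain v m := by
  rw [chainGain, chainGain, chainWeight_congr h,
    Finset.sum_congr rfl fun k hk => h k (Finset.mem_range.1 hk)]

theorem continuous_chainWeight (m : ℕ) : Continuous fun u : ℕ → ℝ => chainWeight u m := by
  induction m with
  | zero => exact continuous_const
  | succ k ih => exact continuous_const.add ((continuous_apply k).mul ih)

/-- A step changes the gain by `e log (W_{k+1} / W_k) - u_k`, and `W_{k+1} / W_k = u_k + 1 / W_k`. -/
theorem chainGain_succ_le {u : ℕ → ℝ} (hu : ∀ k, 0 ≤ u k) (k : ℕ) :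
    chainGain u (k + 1) ≤ chainGain u k + 1 / chainWeight u k := by
  have h0 := chainWeight_pos hu k
  have h1 := chainWeight_pos hu (k + 1)
  have h2 := exp_one_mul_log_le (div_pos h1 h0)
  rw [Real.log_div h1.ne' h0.ne'] at h2
  have h3 : chainWeight u (k + 1) / chainWeight u k = 1 / chainWeight u k + u k := by
    simp only [chainWeight]
    field_simp
  rw [h3] at h2
  simp only [chainGain, Finset.sum_range_succ]
  linarith

theorem chainGain_lt_succ {u : ℕ → ℝ} (hu : ∀ k, 0 ≤ u k) {k : ℕ} (hk : u k = Real.exp 1) :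
    chainGain u k < chainGain u (k + 1) := by
  have h0 := chainWeight_pos hu k
  have he := Real.exp_pos 1
  have h2 : Real.log (Real.exp 1 * chainWeight u k) < Real.log (chainWeight u (k + 1)) := by
    apply Real.log_lt_log (by positivity)
    simp only [chainWeight, hk]
    linarith
  rw [Real.log_mul he.ne' h0.ne', Real.log_exp] at h2
  have h3 := mul_lt_mul_of_pos_left h2 he
  simp only [chainGain, Finset.sum_range_succ, hk]
  linarith

theorem chainGain_le_sum {u : ℕ → ℝ} (hu : ∀ k, 0 ≤ u k) (m : ℕ) :
    chainGain u m ≤ ∑ k ∈ Finset.range m, (Real.exp 1 * Real.log (1 + u k) - u k) := by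
  induction m with
  | zero => simp [chainGain, chainWeight]
  | succ k ih =>
    have h0 := chainWeight_pos hu k
    have h1 := one_le_chainWeight hu k
    have hk := hu k
    have h2 : Real.log (chainWeight u (k + 1)) ≤ Real.log ((1 + u k) * chainWeight u k) := by
      apply Real.log_le_log (chainWeight_pos hu _)
      simp only [chainWeight]
      linarith
    rw [Real.log_mul (by linarith) h0.ne'] at h2
    have h3 := mul_le_mul_of_nonneg_left h2 (Real.exp_pos 1).le
    simp only [chainGain, Finset.sum_range_succ] at ih ⊢
    linarith

/-- Large steps do not pay, so the supremum over chains of a given length is a maximum over a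
compact box. -/
theorem exists_chainGain_max (m : ℕ) :
    ∃ u : ℕ → ℝ, (∀ k, 0 ≤ u k) ∧
      ∀ v : ℕ → ℝ, (∀ k, 0 ≤ v k) → chainGain v m ≤ chainGain u m := by
  set B : ℝ := 2 * m + 10 with hB
  have hB0 : 0 ≤ B := by positivity
  set K : Set (ℕ → ℝ) := Set.pi Set.univ fun _ => Set.Icc (0 : ℝ) B with hK
  have hKc : IsCompact K := isCompact_univ_pi fun _ => isCompact_Icc
  have h0K : (fun _ => 0 : ℕ → ℝ) ∈ K := fun _ _ => ⟨le_rfl, hB0⟩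
  have hcont : ContinuousOn (fun u : ℕ → ℝ => chainGain u m) K := by
    unfold chainGain
    refine ContinuousOn.sub (continuousOn_const.mul
      ((continuous_chainWeight m).continuousOn.log ?_)) ?_
    · intro u hu
      exact (chainWeight_pos (fun k => (hu k trivial).1) m).ne'
    · exact (continuous_finsetSum _ fun k _ => continuous_apply k).continuousOn
  obtain ⟨u, huK, hu⟩ := hKc.exists_isMaxOn ⟨_, h0K⟩ hcont
  refine ⟨u, fun k => (huK k trivial).1, fun v hv => ?_⟩
  by_cases hvB : ∀ k < m, v k ≤ B
  · have hv' : (fun k => if k < m then v k else 0) ∈ K := by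
      intro k _
      by_cases hk : k < m
      · simpa [hk] using ⟨hv k, hvB k hk⟩
      · simpa [hk] using hB0
    rw [chainGain_congr (v := fun k => if k < m then v k else 0) fun k hk => by simp [hk]]
    exact hu hv'
  · push Not at hvB
    obtain ⟨j, hj, hjB⟩ := hvB
    have hzero : chainGain (fun _ => 0) m = 0 := by
      have : chainWeight (fun _ => 0) m = 1 := by cases m <;> simp [chainWeight]
      simp [chainGain, this]
    have h1 : (0 : ℝ) ≤ chainGain u m := hzero ▸ hu h0K
    refine le_trans ((chainGain_le_sum hv m).trans ?_) h1
    rw [← Finset.add_sum_erase _ _ (Finset.mem_range.2 hj)]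
    have h2 : ∑ k ∈ (Finset.range m).erase j, (Real.exp 1 * Real.log (1 + v k) - v k)
        ≤ ∑ k ∈ (Finset.range m).erase j, (1 : ℝ) := by
      refine Finset.sum_le_sum fun k _ => ?_
      have := exp_one_mul_log_le (x := 1 + v k) (by linarith [hv k])
      linarith
    rw [Finset.sum_const, Finset.card_erase_of_mem (Finset.mem_range.2 hj), Finset.card_range,
      nsmul_eq_mul, mul_one, Nat.cast_sub (by omega)] at h2
    -- `log (1 + v) = log ((1 + v) / 2) + log 2` with `log 2 < 1`
    have h3 : Real.exp 1 * Real.log (1 + v j) ≤ (1 + v j) / 2 + Real.exp 1 := by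
      have h4 := exp_one_mul_log_le (x := (1 + v j) / 2) (by linarith [hv j])
      rw [Real.log_div (by linarith [hv j]) two_ne_zero] at h4
      have h5 := Real.log_two_lt_d9
      nlinarith [Real.exp_pos 1]
    have := Real.exp_one_lt_d9
    push_cast at h2
    linarith

theorem chainWeight_update (u : ℕ → ℝ) (t : ℝ) {j m : ℕ} (hj : j < m) :
    chainWeight (Function.update u j t) m =
      chainWeight u m + (t - u j) * (chainWeight u j * ∏ i ∈ Finset.Ico (j + 1) m, u i) := by
  induction m, hj using Nat.le_induction with
  | base =>
    have : chainWeight (Function.update u j t) j = chainWeight u j :=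
      chainWeight_congr fun k hk => Function.update_of_ne hk.ne _ _
    simp only [chainWeight, Function.update_self, this]
    simp
    ring
  | succ m hm ih =>
    rw [Finset.prod_Ico_succ_top hm]
    simp only [chainWeight]
    rw [ih, Function.update_of_ne (by omega)]
    ring

theorem sum_range_update (u : ℕ → ℝ) (t : ℝ) {j m : ℕ} (hj : j < m) :
    ∑ k ∈ Finset.range m, Function.update u j t k = ∑ k ∈ Finset.range m, u k + (t - u j) := by
  rw [Finset.sum_update_of_mem (Finset.mem_range.2 hj),
    ← Finset.add_sum_erase (Finset.range m) u (Finset.mem_range.2 hj), Finset.sdiff_singleton_eq_erase]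
  ring

/-- A chain of maximal gain among the chains with `m` nonnegative steps. -/
def IsMaxChain (u : ℕ → ℝ) (m : ℕ) : Prop :=
  (∀ k, 0 ≤ u k) ∧ ∀ v : ℕ → ℝ, (∀ k, 0 ≤ v k) → chainGain v m ≤ chainGain u m

/-- After a vanishing step the weight is `1` again; the steps up to it could be dropped and
replaced by steps `e` at the end, which increase the gain. -/
theorem IsMaxChain.pos {u : ℕ → ℝ} {m : ℕ} (h : IsMaxChain u m) {j : ℕ} (hj : j < m) :
    0 < u j := by
  refine (h.1 j).lt_of_ne' fun h0 => ?_
  obtain ⟨a, rfl⟩ : ∃ a, m = j + 1 + a := ⟨m - (j + 1), by omega⟩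
  have hW : ∀ k, chainWeight u (j + 1 + k) = chainWeight (fun i => u (j + 1 + i)) k := by
    intro k
    induction k with
    | zero => simp [chainWeight, h0]
    | succ k ih => rw [← add_assoc]; simp only [chainWeight]; rw [ih]
  set v : ℕ → ℝ := fun i => if i < a then u (j + 1 + i) else Real.exp 1 with hv
  have hv0 : ∀ k, 0 ≤ v k := by
    intro k
    simp only [hv]
    split_ifs
    · exact h.1 _
    · exact (Real.exp_pos 1).le
  have h1 : chainGain u (j + 1 + a) ≤ chainGain v a := by
    rw [chainGain_congr (u := v) (v := fun i => u (j + 1 + i)) fun k hk => by simp [hv, hk]]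
    rw [chainGain, chainGain, hW, Finset.sum_range_add]
    have := Finset.sum_nonneg fun k (_ : k ∈ Finset.range (j + 1)) => h.1 k
    linarith
  have h2 : ∀ b, chainGain v a < chainGain v (a + b + 1) := by
    intro b
    induction b with
    | zero => exact chainGain_lt_succ hv0 (by simp [hv])
    | succ b ih => exact ih.trans (chainGain_lt_succ hv0 (by simp [hv]; omega))
  have h3 := h.2 v hv0
  have h4 := h2 j
  rw [show a + j + 1 = j + 1 + a by ring] at h4
  linarith

/-- Stationarity of the gain of a maximal chain in the step `u_j`. -/
theorem IsMaxChain.stationary {u : ℕ → ℝ} {m : ℕ} (h : IsMaxChain u m) {j : ℕ} (hj : j < m) :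
    Real.exp 1 * (chainWeight u j * ∏ i ∈ Finset.Ico (j + 1) m, u i) = chainWeight u m := by
  set β := chainWeight u j * ∏ i ∈ Finset.Ico (j + 1) m, u i with hβ
  have hW := chainWeight_pos h.1 m
  set f : ℝ → ℝ := fun t => Real.exp 1 * Real.log (chainWeight u m + (t - u j) * β)
    - (∑ k ∈ Finset.range m, u k + (t - u j)) with hf
  have hmax : IsLocalMax f (u j) := by
    filter_upwards [lt_mem_nhds (h.pos hj)] with t ht
    have h1 := h.2 (Function.update u j t) fun k => by
      rcases eq_or_ne k j with rfl | hk
      · simpa using ht.le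
      · simpa [hk] using h.1 k
    rw [chainGain, chainWeight_update u t hj, sum_range_update u t hj] at h1
    simpa [hf, chainGain] using h1
  have hd : HasDerivAt f (Real.exp 1 * (β / chainWeight u m) - 1) (u j) := by
    have h1 : HasDerivAt (fun t : ℝ => t - u j) 1 (u j) := (hasDerivAt_id _).sub_const _
    have h2 : HasDerivAt (fun t : ℝ => chainWeight u m + (t - u j) * β) β (u j) := by
      simpa using (h1.mul_const β).const_add (chainWeight u m)
    have h3 := (h2.log (by simpa using hW.ne')).const_mul (Real.exp 1)
    have h4 := h3.sub (h1.const_add (∑ k ∈ Finset.range m, u k))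
    exact h4.congr_deriv (by simp)
  have := hmax.hasDerivAt_eq_zero hd
  field_simp at this
  linarith

theorem IsMaxChain.weight_last {u : ℕ → ℝ} {m : ℕ} (h : IsMaxChain u (m + 1)) :
    chainWeight u (m + 1) = Real.exp 1 * chainWeight u m := by
  simpa using (h.stationary (Nat.lt_succ_self m)).symm

theorem IsMaxChain.weight_succ {u : ℕ → ℝ} {m : ℕ} (h : IsMaxChain u m) {k : ℕ}
    (hk : k + 1 < m) : chainWeight u (k + 1) = u (k + 1) * chainWeight u k := by
  have h1 := h.stationary (show k < m by omega)
  have h2 := h.stationary hk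
  rw [Finset.prod_eq_prod_Ico_succ_bot hk] at h1
  have hQ : 0 < ∏ i ∈ Finset.Ico (k + 1 + 1) m, u i :=
    Finset.prod_pos fun i hi => h.pos (Finset.mem_Ico.1 hi).2
  have h3 := mul_left_cancel₀ (Real.exp_pos 1).ne' (h1.trans h2.symm)
  refine mul_right_cancel₀ hQ.ne' ?_
  rw [← h3]
  ring

/-! ### From cyclic sums to chains -/

/-- A chain with `u_0 ≥ 0`, all later steps at least `1`, total cost at most `D` and final weight
at least `w`. -/
def Reachable (D w : ℝ) : Prop :=
  ∃ (m : ℕ) (u : ℕ → ℝ), 0 ≤ u 0 ∧ (∀ k, 1 ≤ u (k + 1)) ∧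
    ∑ k ∈ Finset.range (m + 1), u k ≤ D ∧ w ≤ chainWeight u (m + 1)

theorem reachable_zero_one : Reachable 0 1 :=
  ⟨0, fun k => if k = 0 then 0 else 1, by simp, by simp, by simp, by simp [chainWeight]⟩

/-- Mass that is not at a record is paid for at the rate of the current record; this does not
cost more than adding it to the first step `u_0`. -/
theorem Reachable.add {D w δ : ℝ} (h : Reachable D w) (hδ : 0 ≤ δ) : Reachable (D + δ) (w + δ) := by
  obtain ⟨m, u, h0, h1, hD, hw⟩ := h
  refine ⟨m, Function.update u 0 (u 0 + δ), by simp; linarith, fun k => by simpa using h1 k, ?_, ?_⟩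
  · rw [sum_range_update u _ (Nat.succ_pos m)]
    linarith
  · rw [chainWeight_update u _ (Nat.succ_pos m)]
    have : 1 ≤ ∏ i ∈ Finset.Ico (0 + 1) (m + 1), u i := by
      refine le_trans (by simp) (Finset.prod_le_prod (f := fun _ => (1 : ℝ)) (by simp) fun i hi => ?_)
      obtain ⟨k, rfl⟩ := Nat.exists_eq_add_of_le' (Finset.mem_Ico.1 hi).1
      exact h1 k
    rw [show chainWeight u 0 = 1 from rfl]
    nlinarith

theorem Reachable.step {D w t : ℝ} (h : Reachable D w) (ht : 1 ≤ t) :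
    Reachable (D + t) (1 + t * w) := by
  obtain ⟨m, u, h0, h1, hD, hw⟩ := h
  have hc : ∀ k < m + 1, Function.update u (m + 1) t k = u k :=
    fun k hk => Function.update_of_ne hk.ne _ _
  refine ⟨m + 1, Function.update u (m + 1) t, by simpa using h0, fun k => ?_, ?_, ?_⟩
  · rcases eq_or_ne k m with rfl | hk
    · simpa using ht
    · rw [Function.update_of_ne (by omega)]
      exact h1 k
  · rw [Finset.sum_range_succ, Finset.sum_congr rfl fun k hk => hc k (Finset.mem_range.1 hk)]
    simpa using hD
  · rw [chainWeight, chainWeight_congr hc, Function.update_self]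
    have := mul_le_mul_of_nonneg_left hw (zero_le_one.trans ht)
    linarith

/-- Read from left to right, a finite sequence traces a chain: `μ_i` is the largest of the terms
after the `i`-th one, the steps are taken at the records (the terms which equal the preceding
`μ`), and `1 + (g_1 + ⋯ + g_i) / μ_i` is the weight reached. -/
theorem reachable_of_records {g μ : ℕ → ℝ} {n : ℕ} (hg : ∀ i, 0 ≤ g i) (hμ : ∀ i ≤ n, 0 < μ i)
    (hrec : ∀ i < n, μ i = max (g (i + 1)) (μ (i + 1))) :
    Reachable (∑ i ∈ Finset.range n, g (i + 1) / μ (i + 1))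
      (1 + (∑ i ∈ Finset.range n, g (i + 1)) / μ n) := by
  induction n with
  | zero => simpa using reachable_zero_one
  | succ i ih =>
    have h := ih (fun j hj => hμ j (by omega)) fun j hj => hrec j (by omega)
    have h0 := hμ (i + 1) le_rfl
    rw [Finset.sum_range_succ, Finset.sum_range_succ]
    rcases le_total (g (i + 1)) (μ (i + 1)) with hle | hle
    · have hμi : μ i = μ (i + 1) := by rw [hrec i (by omega), max_eq_right hle]
      rw [hμi] at h
      convert h.add (div_nonneg (hg (i + 1)) h0.le) using 1
      ring
    · have hμi : μ i = g (i + 1) := by rw [hrec i (by omega), max_eq_left hle]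
      have hg0 : 0 < g (i + 1) := h0.trans_le hle
      rw [hμi] at h
      convert h.step ((one_le_div h0).2 hle) using 1
      field_simp
      ring

/-- The chain inequality for a sequence whose forward means are bounded by later terms. -/
theorem exists_chain_le_sum {g avg : ℕ → ℝ} {N : ℕ} {L : ℝ} (hL : 0 < L) (hg : ∀ i, 0 ≤ g i)
    (hlast : 0 < g (N + 1)) (havg : ∀ i, 0 < avg i)
    (hmid : ∀ i, 1 ≤ i → i ≤ N → ∃ j, i < j ∧ j ≤ N + 1 ∧ avg i ≤ g j)
    (hend : avg (N + 1) ≤ (∑ i ∈ Finset.range (N + 1), g (i + 1)) / L) :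
    ∃ (m : ℕ) (u : ℕ → ℝ), (∀ k, 0 ≤ u k) ∧
      ∑ k ∈ Finset.range m, u k + L / chainWeight u m
        ≤ ∑ i ∈ Finset.range (N + 1), g (i + 1) / avg (i + 1) := by
  -- `μ i` is the maximum of `g j` over `i < j ≤ N + 1`; indices beyond `N` get the value `g (N+1)`
  set μ : ℕ → ℝ := fun i => (Finset.Icc (min (i + 1) (N + 1)) (N + 1)).sup'
    (Finset.nonempty_Icc.2 (min_le_right _ _)) g with hμdef
  have hge : ∀ i j, i < j → j ≤ N + 1 → g j ≤ μ i := fun i j h1 h2 =>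
    Finset.le_sup' g (Finset.mem_Icc.2 ⟨(min_le_left _ _).trans h1, h2⟩)
  have hlastle : ∀ i, g (N + 1) ≤ μ i := fun i =>
    Finset.le_sup' g (Finset.mem_Icc.2 ⟨min_le_right _ _, le_rfl⟩)
  have hμN : μ N = g (N + 1) := by simp [hμdef]
  have hrec : ∀ i < N, μ i = max (g (i + 1)) (μ (i + 1)) := by
    intro i hi
    apply le_antisymm
    · refine Finset.sup'_le _ _ fun j hj => ?_
      rw [Finset.mem_Icc, min_eq_left (by omega)] at hj
      rcases eq_or_lt_of_le hj.1 with rfl | hlt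
      · exact le_max_left _ _
      · exact (hge _ _ hlt hj.2).trans (le_max_right _ _)
    · refine max_le (hge _ _ (Nat.lt_succ_self i) (by omega)) (Finset.sup'_le _ _ fun j hj => ?_)
      rw [Finset.mem_Icc, min_eq_left (by omega)] at hj
      exact hge _ _ (by omega) hj.2
  obtain ⟨m, u, h0, h1, hD, hw⟩ :=
    reachable_of_records (n := N) hg (fun i _ => hlast.trans_le (hlastle i)) hrec
  have hu : ∀ k, 0 ≤ u k := fun k => by
    cases k with
    | zero => exact h0
    | succ k => exact zero_le_one.trans (h1 k)
  refine ⟨m + 1, u, hu, ?_⟩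
  rw [Finset.sum_range_succ (fun i => g (i + 1) / avg (i + 1))]
  refine add_le_add (hD.trans (Finset.sum_le_sum fun i hi => ?_)) ?_
  · obtain ⟨j, h2, h3, h4⟩ := hmid (i + 1) (by omega) (by have := Finset.mem_range.1 hi; omega)
    exact div_le_div_of_nonneg_left (hg _) (havg _) (h4.trans (hge _ _ h2 h3))
  · rw [hμN] at hw
    set G := ∑ i ∈ Finset.range (N + 1), g (i + 1) with hG
    have hG' : G = ∑ i ∈ Finset.range N, g (i + 1) + g (N + 1) := Finset.sum_range_succ _ _
    have hG0 : 0 < G := by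
      rw [hG']
      exact add_pos_of_nonneg_of_pos (Finset.sum_nonneg fun i _ => hg _) hlast
    have hw' : G / g (N + 1) ≤ chainWeight u (m + 1) := by
      refine le_trans (le_of_eq ?_) hw
      rw [hG']
      field_simp
      ring
    calc L / chainWeight u (m + 1) ≤ L / (G / g (N + 1)) :=
          div_le_div_of_nonneg_left hL.le (div_pos hG0 hlast) hw'
      _ = g (N + 1) / (G / L) := by field_simp
      _ ≤ _ := div_le_div_of_nonneg_left (hg _) (havg _) hend

/-! ### Forward means along the natural numbers -/

theorem periodicExt_nat_succ {n : ℕ} (x : Fin n → ℝ) {k : ℕ} (hk : k < n) :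
    periodicExt x ((k + 1 : ℕ) : ℤ) = x ⟨k, hk⟩ := by
  have := periodicExt_apply x ⟨k, hk⟩
  push_cast
  exact this

theorem periodicExt_nat_periodic {n : ℕ} (x : Fin n → ℝ) :
    Function.Periodic (fun k : ℕ => periodicExt x (k : ℤ)) n := by
  intro k
  have := periodicExt_periodic x (k : ℤ)
  simpa using this

theorem periodicExt_nonneg {n : ℕ} {x : Fin n → ℝ} (hx : ∀ i, 0 ≤ x i) (k : ℤ) :
    0 ≤ periodicExt x k := by
  unfold periodicExt
  split_ifs
  · exact hx _
  · exact le_rfl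

theorem intervalAvg_nat {n : ℕ} (x : Fin n → ℝ) (a r : ℕ) :
    intervalAvg x ((a : ℤ) + 1) ((a : ℤ) + (r : ℤ)) =
      (∑ k ∈ Finset.range r, periodicExt x ((a + k + 1 : ℕ) : ℤ)) / r := by
  have h : ∑ j ∈ Finset.Icc ((a : ℤ) + 1) ((a : ℤ) + (r : ℤ)), periodicExt x j =
      ∑ k ∈ Finset.range r, periodicExt x ((a + k + 1 : ℕ) : ℤ) := by
    refine Finset.sum_nbij' (fun j => (j - a - 1).toNat) (fun k => ((a + k + 1 : ℕ) : ℤ))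
      ?_ ?_ ?_ ?_ ?_
    · intro j hj
      rw [Finset.mem_Icc] at hj
      rw [Finset.mem_range]
      omega
    · intro k hk
      rw [Finset.mem_range] at hk
      rw [Finset.mem_Icc]
      omega
    · intro j hj
      rw [Finset.mem_Icc] at hj
      push_cast
      omega
    · intro k hk
      omega
    · intro j hj
      rw [Finset.mem_Icc] at hj
      congr 1
      push_cast
      omega
  rw [intervalAvg, h]
  congr 1
  push_cast
  ring

theorem forwardAvg_eq {n : ℕ} (x : Fin n → ℝ) (r : Fin n → ℕ+) (i : Fin n) :
    forwardAvg x r i =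
      (∑ k ∈ Finset.range (r i), periodicExt x (((i : ℕ) + 1 + k + 1 : ℕ) : ℤ)) / (r i : ℕ) := by
  rw [← intervalAvg_nat, forwardAvg]
  push_cast
  rfl

theorem sum_range_periodic {F : ℕ → ℝ} {n : ℕ} (hF : Function.Periodic F n) (v : ℕ) :
    ∑ i ∈ Finset.range n, F (v + i) = ∑ i ∈ Finset.range n, F i := by
  induction v with
  | zero => simp
  | succ v ih =>
    rw [← ih]
    have h1 := Finset.sum_range_succ (fun i => F (v + i)) n
    have h2 := Finset.sum_range_succ' (fun i => F (v + i)) n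
    have h3 : F (v + n) = F v := hF v
    simp only [add_zero] at h2
    rw [h1, h3] at h2
    have h4 : ∀ i, F (v + 1 + i) = F (v + (i + 1)) := fun i => by congr 1; ring
    simp only [h4]
    linarith

/-- The cycle lemma: some rotation of a periodic sequence has all its forward means at most the
total mean. -/
theorem exists_rotation {f : ℕ → ℝ} {n : ℕ} (hn : 0 < n) (hf : Function.Periodic f n) :
    ∃ v : ℕ, ∀ k : ℕ, ∑ i ∈ Finset.range k, f (v + i) ≤
      k * ((∑ i ∈ Finset.range n, f i) / n) := by
  set T := ∑ i ∈ Finset.range n, f i with hT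
  set Y : ℕ → ℝ := fun k => ∑ i ∈ Finset.range k, f i - k * (T / n) with hY
  have hYp : Function.Periodic Y n := by
    intro k
    have h1 : ∑ i ∈ Finset.range (k + n), f i = ∑ i ∈ Finset.range k, f i + T := by
      rw [Finset.sum_range_add, sum_range_periodic hf]
    have hn' : (n : ℝ) ≠ 0 := by positivity
    simp only [hY, h1]
    push_cast
    field_simp
    ring
  obtain ⟨v, -, hv⟩ := Finset.exists_max_image (Finset.range n) Y ⟨0, Finset.mem_range.2 hn⟩
  refine ⟨v, fun k => ?_⟩
  have h1 := hv ((v + k) % n) (Finset.mem_range.2 (Nat.mod_lt _ hn))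
  rw [hYp.map_mod_nat] at h1
  simp only [hY, Finset.sum_range_add] at h1
  push_cast at h1
  linarith

/-- Every cyclic sum dominates the cost of a chain plus `n` divided by its weight. -/
theorem exists_chain_le_cyclicSum {n : ℕ} (hn : 0 < n) {x : Fin n → ℝ} {r : Fin n → ℕ+}
    (h : Admissible x r) :
    ∃ (m : ℕ) (u : ℕ → ℝ), (∀ k, 0 ≤ u k) ∧
      ∑ k ∈ Finset.range m, u k + n / chainWeight u m ≤ cyclicSum x r := by
  -- positions are shifted by one, so that `f i = x i` and `A i = forwardAvg x r i` for `i < n`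
  set f : ℕ → ℝ := fun k => periodicExt x ((k + 1 : ℕ) : ℤ) with hf
  have hfp : Function.Periodic f n := by
    intro k
    have := periodicExt_nat_periodic x (k + 1)
    simp only [hf]
    rw [show k + n + 1 = k + 1 + n by ring]
    exact this
  have hf0 : ∀ k, 0 ≤ f k := fun k => periodicExt_nonneg h.1 _
  set R : ℕ → ℕ := fun k => r ⟨k % n, Nat.mod_lt _ hn⟩ with hR
  have hRp : Function.Periodic R n := fun k => by simp [hR]
  have hRpos : ∀ k, 0 < R k := fun k => PNat.pos _
  set A : ℕ → ℝ := fun k => (∑ j ∈ Finset.range (R k), f (k + 1 + j)) / R k with hA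
  have hAp : Function.Periodic A n := by
    intro k
    simp only [hA, hRp k]
    congr 1
    refine Finset.sum_congr rfl fun j _ => ?_
    rw [show k + n + 1 + j = k + 1 + j + n by ring]
    exact hfp _
  have hAeq : ∀ i : Fin n, A i = forwardAvg x r i := by
    intro i
    rw [forwardAvg_eq]
    have : R i = r i := by simp [hR, Nat.mod_eq_of_lt i.2]
    simp only [hA, hf, this]
  have hApos : ∀ k, 0 < A k := by
    intro k
    rw [← hAp.map_mod_nat k]
    refine lt_of_le_of_ne (div_nonneg (Finset.sum_nonneg fun j _ => hf0 _) (Nat.cast_nonneg _)) ?_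
    have := h.2 ⟨k % n, Nat.mod_lt _ hn⟩
    rw [← hAeq] at this
    exact this.symm
  have hS : cyclicSum x r = ∑ i ∈ Finset.range n, f i / A i := by
    rw [cyclicSum, Finset.sum_range]
    refine Finset.sum_congr rfl fun i _ => ?_
    rw [hAeq]
    congr 1
    exact (periodicExt_nat_succ x i.2).symm
  set T := ∑ i ∈ Finset.range n, f i with hT
  have hn' : (0 : ℝ) < n := by positivity
  have hTpos : 0 < T := by
    refine lt_of_le_of_ne (Finset.sum_nonneg fun i _ => hf0 i) fun h0 => ?_
    have hz := (Finset.sum_eq_zero_iff_of_nonneg fun i _ => hf0 i).1 h0.symm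
    have hz' : ∀ k, f k = 0 := fun k => by
      rw [← hfp.map_mod_nat k]
      exact hz _ (Finset.mem_range.2 (Nat.mod_lt _ hn))
    have := hApos 0
    simp [hA, hz'] at this
  obtain ⟨v, hv⟩ := exists_rotation hn hfp
  set G : ℕ → ℝ := fun k => ∑ i ∈ Finset.range k, f (v + i) with hG
  have hGT : G n = T := sum_range_periodic hfp v
  have hGn : ∀ k, G (n + k) = T + G k := by
    intro k
    simp only [hG, Finset.sum_range_add]
    rw [← hGT]
    refine congrArg _ (Finset.sum_congr rfl fun j _ => ?_)
    rw [show v + (n + j) = v + j + n by ring]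
    exact hfp _
  obtain ⟨N, rfl⟩ : ∃ N, n = N + 1 := ⟨n - 1, by omega⟩
  have hAG : ∀ i, A (v + i) = (G (i + 1 + R (v + i)) - G (i + 1)) / R (v + i) := by
    intro i
    simp only [hA, hG, Finset.sum_range_add]
    congr 1
    rw [add_sub_cancel_left]
    refine Finset.sum_congr rfl fun j _ => ?_
    congr 1
    ring
  -- the rotated sequence is `g 1, …, g (N + 1)`
  set g : ℕ → ℝ := fun i => f (v + (i - 1)) with hg
  have hGg : ∀ k, G (k + 1) = G k + g (k + 1) := fun k => Finset.sum_range_succ _ _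
  suffices hsuff : 0 < g (N + 1) ∧
      (∀ i, 1 ≤ i → i ≤ N → ∃ j, i < j ∧ j ≤ N + 1 ∧ A (v + (i - 1)) ≤ g j) ∧
      A (v + N) ≤ (∑ i ∈ Finset.range (N + 1), g (i + 1)) / ((N + 1 : ℕ) : ℝ) by
    obtain ⟨m, u, hu, hle⟩ := exists_chain_le_sum (g := g) (avg := fun i => A (v + (i - 1)))
      (N := N) hn' (fun i => hf0 _) hsuff.1 (fun i => hApos _) hsuff.2.1 hsuff.2.2
    refine ⟨m, u, hu, hle.trans (le_of_eq ?_)⟩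
    rw [hS]
    simp only [hg, Nat.add_sub_cancel]
    exact sum_range_periodic (F := fun i => f i / A i) (fun k => by
      change f (k + (N + 1)) / A (k + (N + 1)) = f k / A k
      rw [hfp k, hAp k]) v
  refine ⟨?_, ?_, ?_⟩
  · have h1 := hv N
    have h2 := hGg N
    rw [hGT] at h2
    change G N ≤ _ at h1
    have h3 : (N : ℝ) * (T / ((N + 1 : ℕ) : ℝ)) = T - T / ((N + 1 : ℕ) : ℝ) := by
      push_cast
      field_simp
      ring
    rw [← hT, h3] at h1
    have h4 := div_pos hTpos hn'
    linarith
  · intro i hi hiN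
    obtain ⟨j, hj, hmax⟩ := Finset.exists_max_image (Finset.Ioc i (N + 1)) g
      ⟨N + 1, Finset.mem_Ioc.2 ⟨by omega, le_rfl⟩⟩
    rw [Finset.mem_Ioc] at hj
    refine ⟨j, hj.1, hj.2, ?_⟩
    obtain ⟨i, rfl⟩ := Nat.exists_eq_add_of_le' hi
    simp only [Nat.add_sub_cancel]
    have hinc : ∀ k, i + 1 + k ≤ N + 1 → G (i + 1 + k) - G (i + 1) ≤ k * g j := by
      intro k
      induction k with
      | zero => simp
      | succ k ih =>
        intro hk
        have h1 := ih (by omega)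
        have h2 := hGg (i + 1 + k)
        have h3 := hmax (i + 1 + k + 1) (Finset.mem_Ioc.2 ⟨by omega, by omega⟩)
        push_cast
        rw [← add_assoc]
        linarith
    have hRR : (0 : ℝ) < R (v + i) := by exact_mod_cast hRpos _
    rw [hAG, div_le_iff₀ hRR, mul_comm]
    rcases le_total (i + 1 + R (v + i)) (N + 1) with hle | hle
    · exact hinc _ hle
    · -- the window passes the end of the rotated period; the terms beyond have mean at most
      -- `T / n`, which is at most the mean of the terms up to the end
      obtain ⟨a, ha⟩ := Nat.exists_eq_add_of_le hle
      obtain ⟨c, hc⟩ := Nat.exists_eq_add_of_le (show i + 1 ≤ N + 1 by omega)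
      have h1 := hinc c (by omega)
      rw [← hc, hGT] at h1
      have h2 := hv a
      have h3 := hv (i + 1)
      change G a ≤ _ at h2
      change G (i + 1) ≤ _ at h3
      rw [ha, hGn]
      have hRc : (R (v + i) : ℝ) = c + a := by
        have : R (v + i) = c + a := by omega
        exact_mod_cast this
      have hcpos : (0 : ℝ) < c := by
        have : 0 < c := by omega
        exact_mod_cast this
      have hNc : ((N + 1 : ℕ) : ℝ) = ((i + 1 : ℕ) : ℝ) + c := by rw [hc]; push_cast; ring
      have hTn : T = ((N + 1 : ℕ) : ℝ) * (T / ((N + 1 : ℕ) : ℝ)) := by field_simp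
      rw [← hT] at h2 h3
      set q := T / ((N + 1 : ℕ) : ℝ) with hq
      rw [hNc] at hTn
      have h4 : q ≤ g j := by
        refine le_of_mul_le_mul_left ?_ hcpos
        linarith
      have h5 := mul_le_mul_of_nonneg_left h4 (Nat.cast_nonneg (α := ℝ) a)
      rw [hRc]
      linarith
  · have hRR : (0 : ℝ) < R (v + N) := by exact_mod_cast hRpos _
    change A (v + N) ≤ G (N + 1) / _
    rw [hAG, hGn, hGT, div_le_iff₀ hRR, mul_comm]
    have := hv (R (v + N))
    change G _ ≤ _ at this
    linarith

/-! ### Chains are realised by cyclic sums -/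

/-- A chain of `m < n` steps is realised by a sequence `b_0, …, b_m, 0, …, 0` with
`b_k / b_{k+1} = u_k`: the first `m` denominators are single terms, the others the total mean. -/
theorem exists_cyclicSum_eq {n m : ℕ} (hm : m < n) {u : ℕ → ℝ} (hu : ∀ k, 0 < u k) :
    ∃ (x : Fin n → ℝ) (r : Fin n → ℕ+), Admissible x r ∧
      cyclicSum x r = ∑ k ∈ Finset.range m, u k + n / chainWeight u m := by
  set b : ℕ → ℝ := fun k => ∏ i ∈ Finset.range k, (u i)⁻¹ with hb
  have hbpos : ∀ k, 0 < b k := fun k => Finset.prod_pos fun i _ => inv_pos.2 (hu i)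
  have hbs : ∀ k, b k / b (k + 1) = u k := fun k => by
    have h1 := (hbpos k).ne'
    have h2 := (hu k).ne'
    have h3 : b (k + 1) = b k * (u k)⁻¹ := Finset.prod_range_succ _ _
    rw [h3]
    field_simp
  have hbW : ∀ k, ∑ i ∈ Finset.range (k + 1), b i = b k * chainWeight u k := by
    intro k
    induction k with
    | zero => simp [chainWeight]
    | succ k ih =>
      have h3 : b (k + 1) = b k * (u k)⁻¹ := Finset.prod_range_succ _ _
      have h2 := (hu k).ne'
      rw [Finset.sum_range_succ, ih, h3]
      simp only [chainWeight]
      field_simp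
      ring
  have hn : 0 < n := by omega
  set x : Fin n → ℝ := fun i => if (i : ℕ) ≤ m then b i else 0 with hx
  set r : Fin n → ℕ+ := fun i => if (i : ℕ) < m then 1 else ⟨n, hn⟩ with hr
  have hT : ∑ i, x i = b m * chainWeight u m := by
    rw [← hbW, ← Finset.sum_range (n := n) (fun i => if i ≤ m then b i else 0), ← Finset.sum_filter]
    refine Finset.sum_congr ?_ fun _ _ => rfl
    ext i
    simp only [Finset.mem_filter, Finset.mem_range]
    omega
  have hW := chainWeight_pos (fun k => (hu k).le) m
  have hTpos : 0 < ∑ i, x i := hT ▸ mul_pos (hbpos m) hW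
  have havg1 : ∀ i : Fin n, (i : ℕ) < m → forwardAvg x r i = b (i + 1) := by
    intro i hi
    rw [forwardAvg_eq]
    have : r i = 1 := by simp [hr, hi]
    rw [this]
    simp only [PNat.one_coe, Finset.sum_range_one, Nat.cast_one, div_one, add_zero]
    rw [periodicExt_nat_succ x (show (i : ℕ) + 1 < n by omega)]
    simp only [hx]
    rw [if_pos (by omega)]
  have havg2 : ∀ i : Fin n, m ≤ (i : ℕ) → forwardAvg x r i = (∑ i, x i) / n := by
    intro i hi
    rw [forwardAvg_eq]
    have : r i = ⟨n, hn⟩ := if_neg (not_lt.2 hi)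
    rw [this]
    simp only [PNat.mk_coe]
    congr 1
    have hp : Function.Periodic (fun k : ℕ => periodicExt x ((k + 1 : ℕ) : ℤ)) n := by
      intro k
      have := periodicExt_nat_periodic x (k + 1)
      change periodicExt x ((k + n + 1 : ℕ) : ℤ) = _
      rw [show k + n + 1 = k + 1 + n by ring]
      exact this
    rw [sum_range_periodic hp (i + 1), Finset.sum_range]
    exact Finset.sum_congr rfl fun j _ => periodicExt_nat_succ x j.2
  refine ⟨x, r, ⟨fun i => ?_, fun i => ?_⟩, ?_⟩
  · simp only [hx]
    split_ifs
    · exact (hbpos _).le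
    · exact le_rfl
  · rcases lt_or_ge (i : ℕ) m with hi | hi
    · rw [havg1 i hi]
      exact (hbpos _).ne'
    · rw [havg2 i hi]
      exact (div_pos hTpos (by exact_mod_cast hn)).ne'
  · have hterm : ∀ i : Fin n, x i / forwardAvg x r i =
        if (i : ℕ) < m then u i else if (i : ℕ) = m then n / chainWeight u m else 0 := by
      intro i
      rcases lt_or_ge (i : ℕ) m with hi | hi
      · rw [havg1 i hi, if_pos hi, ← hbs]
        simp only [hx]
        rw [if_pos hi.le]
      · rw [havg2 i hi, if_neg (not_lt.2 hi), hT]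
        simp only [hx]
        rcases eq_or_lt_of_le hi with hi' | hi'
        · rw [if_pos hi'.ge, if_pos hi'.symm, ← hi']
          have := (hbpos m).ne'
          field_simp
        · rw [if_neg (by omega), if_neg (by omega), zero_div]
    rw [cyclicSum, Finset.sum_congr rfl fun i _ => hterm i,
      ← Finset.sum_range (n := n)
        (fun i => if i < m then u i else if i = m then n / chainWeight u m else 0),
      ← Finset.sum_subset (Finset.range_subset_range.2 (show m + 1 ≤ n from hm)),
      Finset.sum_range_succ]
    · congr 1
      · exact Finset.sum_congr rfl fun i hi => by rw [if_pos (Finset.mem_range.1 hi)]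
      · simp
    · intro i _ hi
      rw [Finset.mem_range] at hi
      rw [if_neg (by omega), if_neg (by omega)]

/-! ### The two-sided comparison of the infimum with chains -/

theorem cyclicSum_nonneg {n : ℕ} {x : Fin n → ℝ} {r : Fin n → ℕ+} (h : Admissible x r) :
    0 ≤ cyclicSum x r := by
  refine Finset.sum_nonneg fun i _ => div_nonneg (h.1 i) ?_
  rw [forwardAvg_eq]
  exact div_nonneg (Finset.sum_nonneg fun k _ => periodicExt_nonneg h.1 _) (Nat.cast_nonneg _)

theorem lowerBound_le {n : ℕ} {x : Fin n → ℝ} {r : Fin n → ℕ+} (h : Admissible x r) :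
    lowerBound n ≤ cyclicSum x r := by
  have h1 : ∀ r' : Fin n → ℕ+, 0 ≤ lowerBoundFor r' := fun r' =>
    Real.sInf_nonneg (by rintro s ⟨y, hy, rfl⟩; exact cyclicSum_nonneg hy)
  refine (ciInf_le ⟨0, by rintro s ⟨r', rfl⟩; exact h1 r'⟩ r).trans (csInf_le ⟨0, ?_⟩ ⟨x, h, rfl⟩)
  rintro s ⟨y, hy, rfl⟩
  exact cyclicSum_nonneg hy

theorem le_lowerBound {n : ℕ} (hn : 0 < n) {c : ℝ}
    (h : ∀ (x : Fin n → ℝ) (r : Fin n → ℕ+), Admissible x r → c ≤ cyclicSum x r) :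
    c ≤ lowerBound n := by
  refine le_ciInf fun r => le_csInf ⟨_, fun _ => 1, ⟨fun _ => zero_le_one, fun i => ?_⟩, rfl⟩ ?_
  · rw [forwardAvg_eq]
    have h1 : ∀ k : ℤ, periodicExt (fun _ : Fin n => (1 : ℝ)) k = 1 := fun k => by
      simp [periodicExt, hn]
    simp [h1]
  · rintro s ⟨x, hx, rfl⟩
    exact h x r hx

theorem lowerBound_le_chain {n m : ℕ} (hm : m < n) {u : ℕ → ℝ} (hu : ∀ k, 0 < u k) :
    lowerBound n ≤ ∑ k ∈ Finset.range m, u k + n / chainWeight u m := by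
  obtain ⟨x, r, h, hS⟩ := exists_cyclicSum_eq hm hu
  exact hS ▸ lowerBound_le h

/-- If `A` bounds the gain of all chains, then `n / W ≥ e log n - e log W` gives the lower
estimate without any error term. -/
theorem le_lowerBound_of_gain_le {A : ℝ}
    (hA : ∀ (m : ℕ) (u : ℕ → ℝ), (∀ k, 0 ≤ u k) → chainGain u m ≤ A) {n : ℕ} (hn : 0 < n) :
    Real.exp 1 * Real.log n - A ≤ lowerBound n := by
  refine le_lowerBound hn fun x r h => ?_
  obtain ⟨m, u, hu, hle⟩ := exists_chain_le_cyclicSum hn h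
  refine le_trans ?_ hle
  have h1 := hA m u hu
  have hW := chainWeight_pos hu m
  have hn' : (0 : ℝ) < n := by exact_mod_cast hn
  have h2 := exp_one_mul_log_le (div_pos hn' hW)
  rw [Real.log_div hn'.ne' hW.ne'] at h2
  rw [chainGain] at h1
  linarith

/-! ### The recursion of stationary chains -/

/-- The ratios `U_k = W_{k+1} / W_k` and weights `V_k = W_{k+1}` of the stationary chain which has
weight `s` after its first step: `U_0 = V_0 = s`, `U_{k+1} = U_k + 1 / V_k`,
`V_{k+1} = U_{k+1} V_k`. -/
noncomputable def orbit (s : ℝ) : ℕ → ℝ × ℝ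
  | 0 => (s, s)
  | k + 1 => ((orbit s k).1 + 1 / (orbit s k).2,
      ((orbit s k).1 + 1 / (orbit s k).2) * (orbit s k).2)

/-- The ratio `U_k` of the stationary chain. -/
noncomputable def orbitRatio (s : ℝ) (k : ℕ) : ℝ := (orbit s k).1

/-- The weight `V_k` of the stationary chain. -/
noncomputable def orbitWeight (s : ℝ) (k : ℕ) : ℝ := (orbit s k).2

theorem orbitRatio_zero (s : ℝ) : orbitRatio s 0 = s := rfl

theorem orbitWeight_zero (s : ℝ) : orbitWeight s 0 = s := rfl

theorem orbitRatio_succ (s : ℝ) (k : ℕ) :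
    orbitRatio s (k + 1) = orbitRatio s k + 1 / orbitWeight s k := rfl

theorem orbitWeight_succ (s : ℝ) (k : ℕ) :
    orbitWeight s (k + 1) = orbitRatio s (k + 1) * orbitWeight s k := rfl

theorem orbit_pos {s : ℝ} (hs : 0 < s) (k : ℕ) : 0 < orbitRatio s k ∧ 0 < orbitWeight s k := by
  induction k with
  | zero => exact ⟨hs, hs⟩
  | succ k ih =>
    have h1 : 0 < orbitRatio s (k + 1) := by
      rw [orbitRatio_succ]
      exact add_pos ih.1 (one_div_pos.2 ih.2)
    exact ⟨h1, by rw [orbitWeight_succ]; exact mul_pos h1 ih.2⟩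

theorem orbitWeight_succ' {s : ℝ} (hs : 0 < s) (k : ℕ) :
    orbitWeight s (k + 1) = 1 + orbitRatio s k * orbitWeight s k := by
  have := (orbit_pos hs k).2.ne'
  rw [orbitWeight_succ, orbitRatio_succ]
  field_simp
  ring

theorem orbitRatio_monotone {s : ℝ} (hs : 0 < s) : Monotone (orbitRatio s) := by
  refine monotone_nat_of_le_succ fun k => ?_
  rw [orbitRatio_succ]
  have := one_div_pos.2 (orbit_pos hs k).2
  linarith

theorem two_le_orbitRatio {s : ℝ} (hs : 0 < s) {k : ℕ} (hk : 1 ≤ k) : 2 ≤ orbitRatio s k := by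
  refine le_trans ?_ (orbitRatio_monotone hs hk)
  rw [orbitRatio_succ, orbitRatio_zero, orbitWeight_zero]
  have h : s + 1 / s - 2 = (s - 1) ^ 2 / s := by
    field_simp
    ring
  have := div_nonneg (sq_nonneg (s - 1)) hs.le
  linarith

/-- The weights grow at least by the factor `θ`, so the remaining increments of the ratio are
dominated by a geometric series. -/
theorem orbitRatio_add_le {s θ : ℝ} (hs : 0 < s) (hθ : 1 < θ) {k : ℕ}
    (hk : θ ≤ orbitRatio s (k + 1)) (j : ℕ) :
    orbitRatio s (k + j) ≤ orbitRatio s k + θ / (θ - 1) / orbitWeight s k := by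
  have hc : 0 < θ / (θ - 1) := div_pos (by linarith) (by linarith)
  have key : ∀ j, orbitRatio s (k + j) + θ / (θ - 1) / orbitWeight s (k + j) ≤
      orbitRatio s k + θ / (θ - 1) / orbitWeight s k := by
    intro j
    induction j with
    | zero => exact le_rfl
    | succ j ih =>
      refine le_trans ?_ ih
      have hV := (orbit_pos hs (k + j)).2
      have hU : θ ≤ orbitRatio s (k + j + 1) :=
        hk.trans (orbitRatio_monotone hs (by omega))
      rw [← add_assoc, orbitWeight_succ, orbitRatio_succ]
      rw [orbitRatio_succ] at hU
      set U := orbitRatio s (k + j) + 1 / orbitWeight s (k + j) with hUdef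
      have h1 : θ / (θ - 1) / (U * orbitWeight s (k + j)) ≤
          θ / (θ - 1) / (θ * orbitWeight s (k + j)) :=
        div_le_div_of_nonneg_left hc.le (by positivity)
          (mul_le_mul_of_nonneg_right hU hV.le)
      have h2 : 1 / orbitWeight s (k + j) + θ / (θ - 1) / (θ * orbitWeight s (k + j)) =
          θ / (θ - 1) / orbitWeight s (k + j) := by
        have : θ - 1 ≠ 0 := by linarith
        have : θ ≠ 0 := by linarith
        field_simp
        ring
      linarith
  have := div_pos hc (orbit_pos hs (k + j)).2
  linarith [key j]

/-- The part of the gain of a stationary chain that comes from the steps `U_0, …, U_K`. -/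
noncomputable def orbitGain (s : ℝ) (K : ℕ) : ℝ :=
  Real.exp 1 * Real.log (orbitWeight s K) - ∑ k ∈ Finset.range (K + 1), orbitRatio s k

theorem orbitGain_antitone {s : ℝ} (hs : 0 < s) : Antitone (orbitGain s) := by
  refine antitone_nat_of_succ_le fun K => ?_
  have h1 := orbit_pos hs K
  have h2 := orbit_pos hs (K + 1)
  have h3 := exp_one_mul_log_le h2.1
  rw [orbitGain, orbitGain, orbitWeight_succ, Real.log_mul h2.1.ne' h1.2.ne',
    Finset.sum_range_succ _ (K + 1)]
  linarith

theorem IsMaxChain.eq_orbit {u : ℕ → ℝ} {m : ℕ} (h : IsMaxChain u (m + 2)) {k : ℕ} (hk : k ≤ m) :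
    u (k + 1) = orbitRatio (1 + u 0) k ∧ chainWeight u (k + 1) = orbitWeight (1 + u 0) k := by
  have hs : 0 < 1 + u 0 := by linarith [h.1 0]
  induction k with
  | zero =>
    have h1 := h.weight_succ (show 0 + 1 < m + 2 by omega)
    simp only [chainWeight, mul_one, zero_add] at h1 ⊢
    exact ⟨h1.symm, rfl⟩
  | succ k ih =>
    obtain ⟨h1, h2⟩ := ih (by omega)
    have h3 : chainWeight u (k + 1 + 1) = orbitWeight (1 + u 0) (k + 1) := by
      rw [orbitWeight_succ' hs, chainWeight, h1, h2]
    have h4 := h.weight_succ (show k + 1 + 1 < m + 2 by omega)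
    refine ⟨?_, h3⟩
    rw [h3, h2, orbitWeight_succ] at h4
    exact (mul_right_cancel₀ (orbit_pos hs k).2.ne' h4).symm

/-- The terminal condition that selects `s`. -/
theorem IsMaxChain.orbitRatio_eq {u : ℕ → ℝ} {m : ℕ} (h : IsMaxChain u (m + 2)) :
    orbitRatio (1 + u 0) (m + 1) = Real.exp 1 := by
  have hs : 0 < 1 + u 0 := by linarith [h.1 0]
  obtain ⟨h1, h2⟩ := h.eq_orbit le_rfl
  have h3 := h.weight_last
  rw [chainWeight, h1, h2, ← orbitWeight_succ' hs, orbitWeight_succ] at h3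
  exact mul_right_cancel₀ (orbit_pos hs m).2.ne' h3

theorem IsMaxChain.gain_eq {u : ℕ → ℝ} {m : ℕ} (h : IsMaxChain u (m + 2)) :
    chainGain u (m + 2) = Real.exp 1 + 1 - (1 + u 0) + orbitGain (1 + u 0) m := by
  have hs : 0 < 1 + u 0 := by linarith [h.1 0]
  rw [chainGain, h.weight_last, (h.eq_orbit le_rfl).2,
    Real.log_mul (Real.exp_pos 1).ne' (orbit_pos hs m).2.ne', Real.log_exp, Finset.sum_range_succ',
    Finset.sum_congr rfl fun k hk => (h.eq_orbit (Nat.lt_succ_iff.1 (Finset.mem_range.1 hk))).1,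
    orbitGain]
  ring

/-- Every stationary sequence is a chain, whether or not it satisfies the terminal condition. -/
theorem exists_chain_of_orbit {s : ℝ} (hs : 1 ≤ s) (m : ℕ) :
    ∃ u : ℕ → ℝ, (∀ k, 0 ≤ u k) ∧ chainGain u (m + 1) =
      Real.exp 1 * Real.log (orbitWeight s m) -
        (∑ k ∈ Finset.range m, orbitRatio s k + (s - 1)) := by
  have hs0 : 0 < s := by linarith
  set u : ℕ → ℝ := fun k => Nat.casesOn k (s - 1) (orbitRatio s) with hu
  have hW : ∀ k, chainWeight u (k + 1) = orbitWeight s k := by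
    intro k
    induction k with
    | zero => simp [chainWeight, hu, orbitWeight_zero]
    | succ k ih =>
      rw [chainWeight, ih, orbitWeight_succ' hs0]
  refine ⟨u, fun k => ?_, ?_⟩
  · cases k with
    | zero => simpa [hu] using hs
    | succ k => exact (orbit_pos hs0 k).1.le
  · rw [chainGain, hW, Finset.sum_range_succ']
    rfl

/-- In the range `s' ≥ 1.7` the ratios increase with the parameter. With `d_k` the difference of the
ratios, the increments of `d_k` are controlled by the relative difference of the weights, which is
at most `a (s - s')` for a number `a` that grows by at most `1 / θ` at each step. -/
theorem orbitRatio_mono {s' s : ℝ} (hs' : 1.7 ≤ s') (hss : s' ≤ s) (k : ℕ) :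
    orbitRatio s' k ≤ orbitRatio s k := by
  have hs0' : 0 < s' := by linarith
  have hs0 : 0 < s := by linarith
  -- `θ = 2.288` is a lower bound for `s' + 1 / s'`; the coefficients `17765 / 10000` and
  -- `604 / 1000` exceed `θ / (θ - 1)` and `1 / (θ - 1) ^ 2`
  have hθ : (2.288 : ℝ) ≤ s' + 1 / s' := by
    have h1 : s' + 1 / s' - 2.288 = (s' ^ 2 - 2.288 * s' + 1) / s' := by
      field_simp
      ring
    have h2 : 0 ≤ (s' ^ 2 - 2.288 * s' + 1) / s' := div_nonneg (by nlinarith) hs0'.le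
    linarith
  have key : ∀ k, ∃ a : ℝ, 0 ≤ a ∧ orbitWeight s' k ≤ orbitWeight s k ∧
      orbitRatio s k - orbitRatio s' k ≤ s - s' ∧
      (s - s') * (1.7765 * a + 0.604) ≤
        (orbitRatio s k - orbitRatio s' k) * orbitWeight s' k ∧
      orbitWeight s k - orbitWeight s' k ≤ a * (s - s') * orbitWeight s k := by
    intro k
    induction k with
    | zero =>
      refine ⟨1 / 1.7, by norm_num, hss, le_rfl, ?_, ?_⟩
      · simp only [orbitRatio_zero, orbitWeight_zero]
        refine mul_le_mul_of_nonneg_left ?_ (by linarith)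
        refine le_trans ?_ hs'
        norm_num
      · simp only [orbitWeight_zero]
        have h1 : 1 ≤ 1 / 1.7 * s := by linarith
        nlinarith
    | succ k ih =>
      obtain ⟨a, ha, hVV, h1, h2, h3⟩ := ih
      have hV := (orbit_pos hs0 k).2
      have hV' := (orbit_pos hs0' k).2
      have hθ' : 2.288 ≤ orbitRatio s' (k + 1) :=
        hθ.trans (orbitRatio_monotone hs0' (show 1 ≤ k + 1 by omega))
      have hr := orbitRatio_succ s k
      have hr' := orbitRatio_succ s' k
      set U := orbitRatio s k
      set U' := orbitRatio s' k
      set V := orbitWeight s k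
      set V' := orbitWeight s' k
      set X := orbitRatio s (k + 1)
      set X' := orbitRatio s' (k + 1)
      have hΔ : 0 ≤ s - s' := by linarith
      have hd : 0 ≤ U - U' := by
        refine nonneg_of_mul_nonneg_left (le_trans ?_ h2) hV'
        exact mul_nonneg hΔ (by linarith)
      have hinv : 1 / V' - 1 / V = (V - V') / (V * V') := by field_simp
      have h4 : 1 / V' - 1 / V ≤ a * (s - s') / V' := by
        rw [hinv, div_le_div_iff₀ (by positivity) hV']
        nlinarith [mul_le_mul_of_nonneg_right h3 hV'.le]
      have h5 : (U - U') * V' - a * (s - s') ≤ (X - X') * V' := by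
        have h6 := mul_le_mul_of_nonneg_right h4 hV'.le
        rw [div_mul_cancel₀ _ hV'.ne'] at h6
        have h7 : X - X' = (U - U') - (1 / V' - 1 / V) := by rw [hr, hr']; ring
        rw [h7]
        linarith
      have h8 : (s - s') * (0.7765 * a + 0.604) ≤ (X - X') * V' := by linarith
      have hX : 0 ≤ X - X' := by
        refine nonneg_of_mul_nonneg_left (le_trans ?_ h8) hV'
        exact mul_nonneg hΔ (by linarith)
      have hXΔ : X - X' ≤ s - s' := by
        have := one_div_le_one_div_of_le hV' hVV
        linarith
      refine ⟨a + 1 / 2.288, by positivity, ?_, hXΔ, ?_, ?_⟩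
      · rw [orbitWeight_succ, orbitWeight_succ]
        exact mul_le_mul (by linarith) hVV hV'.le (by linarith)
      · rw [orbitWeight_succ s' k]
        change _ ≤ (X - X') * (X' * V')
        have h9 : 2.288 * ((X - X') * V') ≤ X' * ((X - X') * V') :=
          mul_le_mul_of_nonneg_right hθ' (mul_nonneg hX hV'.le)
        have h10 : (s - s') * (1.7765 * (a + 1 / 2.288) + 0.604) ≤
            2.288 * ((s - s') * (0.7765 * a + 0.604)) := by
          rw [mul_left_comm]
          refine mul_le_mul_of_nonneg_left ?_ hΔ
          norm_num
          linarith
        nlinarith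
      · rw [orbitWeight_succ s' k, orbitWeight_succ s k]
        change X * V - X' * V' ≤ (a + 1 / 2.288) * (s - s') * (X * V)
        have h9 : X * (V - V') ≤ X * (a * (s - s') * V) :=
          mul_le_mul_of_nonneg_left h3 (by linarith)
        have h10 : (X - X') * V' ≤ (s - s') * V := mul_le_mul hXΔ hVV hV'.le hΔ
        have h11 : (s - s') * V ≤ 1 / 2.288 * (s - s') * (X * V) := by
          have h12 : 1 ≤ 1 / 2.288 * X := by linarith
          have h13 := mul_le_mul_of_nonneg_left h12 (mul_nonneg hΔ hV.le)
          linarith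
        linarith
  obtain ⟨a, ha, -, -, h2, -⟩ := key k
  have h3 := nonneg_of_mul_nonneg_left
    ((mul_nonneg (sub_nonneg.2 hss) (by linarith)).trans h2) (orbit_pos hs0' k).2
  linarith

/-! ### The length dependence of the maximal gain -/

theorem IsMaxChain.two_mul_weight_le {u : ℕ → ℝ} {m : ℕ} (h : IsMaxChain u m) {k : ℕ}
    (hk : 1 ≤ k) (hkm : k < m) : 2 * chainWeight u k ≤ chainWeight u (k + 1) := by
  have hW := chainWeight_pos h.1 k
  obtain ⟨k, rfl⟩ := Nat.exists_eq_add_of_le' hk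
  obtain ⟨m, rfl⟩ := Nat.exists_eq_add_of_le' (show 2 ≤ m by omega)
  have hs : 0 < 1 + u 0 := by linarith [h.1 0]
  rcases Nat.lt_or_ge (k + 1 + 1) (m + 2) with hlt | hge
  · rw [h.weight_succ hlt, (h.eq_orbit (show k + 1 ≤ m by omega)).1]
    exact mul_le_mul_of_nonneg_right (two_le_orbitRatio hs (by omega)) hW.le
  · obtain rfl : k = m := by omega
    rw [h.weight_last]
    have := Real.exp_one_gt_d9
    exact mul_le_mul_of_nonneg_right (by linarith) hW.le

theorem IsMaxChain.two_pow_le_weight {u : ℕ → ℝ} {m : ℕ} (h : IsMaxChain u m) {k : ℕ}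
    (hkm : k + 1 ≤ m) : 2 ^ k ≤ chainWeight u (k + 1) := by
  induction k with
  | zero => simpa using one_le_chainWeight h.1 1
  | succ k ih =>
    have h1 := ih (by omega)
    have h2 := h.two_mul_weight_le (k := k + 1) (by omega) (by omega)
    rw [pow_succ]
    linarith

/-- Truncating a maximal chain costs little. -/
theorem IsMaxChain.gain_le_truncate {u : ℕ → ℝ} {m K : ℕ} (h : IsMaxChain u m) (hK : 1 ≤ K)
    (hKm : K ≤ m) : chainGain u m ≤ chainGain u K + 2 / chainWeight u K := by
  have key : ∀ j, K + j ≤ m → chainGain u (K + j) + 2 / chainWeight u (K + j) ≤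
      chainGain u K + 2 / chainWeight u K := by
    intro j
    induction j with
    | zero => intro _; exact le_rfl
    | succ j ih =>
      intro hj
      refine le_trans ?_ (ih (by omega))
      have hW := chainWeight_pos h.1 (K + j)
      have h1 := chainGain_succ_le h.1 (K + j)
      have h2 := h.two_mul_weight_le (k := K + j) (by omega) (by omega)
      have h3 : 2 / chainWeight u (K + j + 1) ≤ 2 / (2 * chainWeight u (K + j)) :=
        div_le_div_of_nonneg_left zero_le_two (by positivity) h2
      have h4 : 2 / (2 * chainWeight u (K + j)) = 1 / chainWeight u (K + j) := by
        field_simp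
      have h5 : 2 / chainWeight u (K + j) = 1 / chainWeight u (K + j) +
        1 / chainWeight u (K + j) := by ring
      rw [← add_assoc]
      linarith
  have h1 := key (m - K) (by omega)
  rw [Nat.add_sub_cancel' hKm] at h1
  have := div_pos two_pos (chainWeight_pos h.1 m)
  linarith

theorem exists_chainGain_ge {v : ℕ → ℝ} (hv : ∀ k, 0 ≤ v k) {m M : ℕ} (h : m ≤ M) :
    ∃ u : ℕ → ℝ, (∀ k, 0 ≤ u k) ∧ chainGain v m ≤ chainGain u M := by
  set u : ℕ → ℝ := fun k => if k < m then v k else Real.exp 1 with hu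
  have hu0 : ∀ k, 0 ≤ u k := by
    intro k
    simp only [hu]
    split_ifs
    · exact hv k
    · exact (Real.exp_pos 1).le
  refine ⟨u, hu0, ?_⟩
  rw [chainGain_congr (u := v) (v := u) fun k hk => by simp [hu, hk]]
  induction M, h using Nat.le_induction with
  | base => exact le_rfl
  | succ M hM ih => exact ih.trans (chainGain_lt_succ hu0 (by simp [hu]; omega)).le

/-- A maximal chain with `K + 1` steps is optimal among all chains up to `2 / 2 ^ K`. -/
theorem IsMaxChain.gain_le {u : ℕ → ℝ} {K : ℕ} (h : IsMaxChain u (K + 1)) {v : ℕ → ℝ}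
    (hv : ∀ k, 0 ≤ v k) (m : ℕ) : chainGain v m ≤ chainGain u (K + 1) + 2 / 2 ^ K := by
  have hpos : (0 : ℝ) < 2 / 2 ^ K := by positivity
  obtain ⟨v', hv', hle⟩ := exists_chainGain_ge hv (le_max_left m (K + 1))
  obtain ⟨w, hw⟩ : ∃ w, IsMaxChain w (max m (K + 1)) := exists_chainGain_max _
  have h1 := hw.2 v' hv'
  have h2 := hw.gain_le_truncate (K := K + 1) (by omega) (le_max_right _ _)
  have h3 := h.2 w hw.1
  have h4 := hw.two_pow_le_weight (k := K) (le_max_right _ _)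
  have h5 : 2 / chainWeight w (K + 1) ≤ 2 / 2 ^ K :=
    div_le_div_of_nonneg_left zero_le_two (by positivity) h4
  linarith

/-! ### Fixed-point enclosures of stationary chains -/

/-- Enclosures, in units of `10⁻²⁰`, of the ratio `U_k`, the weight `V_k` and the sum
`U_0 + ⋯ + U_{k-1}` of the stationary chains whose parameter lies between `a` and `b` units: the
pairs are lower and upper bounds, rounded outwards. -/
def enclosure (a b : ℕ) : ℕ → ℕ × ℕ × ℕ × ℕ × ℕ × ℕ
  | 0 => (a, b, a, b, 0, 0)
  | k + 1 =>
    match enclosure a b k with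
    | (ul, uh, wl, wh, tl, th) =>
      (ul + 10 ^ 40 / wh, uh + (10 ^ 40 / wl + 1), (ul + 10 ^ 40 / wh) * wl / 10 ^ 20,
        (uh + (10 ^ 40 / wl + 1)) * wh / 10 ^ 20 + 1, tl + ul, th + uh)

theorem div_le_natDiv_add_one (x : ℕ) {y : ℕ} (hy : 0 < y) :
    (x : ℝ) / y ≤ ((x / y + 1 : ℕ) : ℝ) := by
  rw [div_le_iff₀ (by exact_mod_cast hy), mul_comm]
  exact_mod_cast (Nat.lt_mul_div_succ x hy).le

theorem enclosure_sound {a b : ℕ} {s : ℝ} (ha : 10 ^ 20 ≤ a) (hs : (a : ℝ) ≤ s * 10 ^ 20)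
    (hs' : s * 10 ^ 20 ≤ b) {k ul uh wl wh tl th : ℕ}
    (h : enclosure a b k = (ul, uh, wl, wh, tl, th)) :
    10 ^ 20 ≤ ul ∧ 10 ^ 20 ≤ wl ∧
      (ul : ℝ) ≤ orbitRatio s k * 10 ^ 20 ∧ orbitRatio s k * 10 ^ 20 ≤ uh ∧
      (wl : ℝ) ≤ orbitWeight s k * 10 ^ 20 ∧ orbitWeight s k * 10 ^ 20 ≤ wh ∧
      (tl : ℝ) ≤ (∑ i ∈ Finset.range k, orbitRatio s i) * 10 ^ 20 ∧
      (∑ i ∈ Finset.range k, orbitRatio s i) * 10 ^ 20 ≤ th := by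
  have hs0 : 0 < s := by
    have : ((10 ^ 20 : ℕ) : ℝ) ≤ a := by exact_mod_cast ha
    push_cast at this
    linarith
  induction k generalizing ul uh wl wh tl th with
  | zero =>
    simp only [enclosure, Prod.mk.injEq] at h
    obtain ⟨rfl, rfl, rfl, rfl, rfl, rfl⟩ := h
    simpa [orbitRatio_zero, orbitWeight_zero, hs, hs'] using ha
  | succ k ih =>
    rcases hE : enclosure a b k with ⟨ul₀, uh₀, wl₀, wh₀, tl₀, th₀⟩
    obtain ⟨i1, i2, i3, i4, i5, i6, i7, i8⟩ := ih hE
    simp only [enclosure, hE, Prod.mk.injEq] at h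
    obtain ⟨h1, h2, h3, h4, rfl, rfl⟩ := h
    rw [h1] at h3
    rw [h2] at h4
    have hU := (orbit_pos hs0 k).1
    have hV := (orbit_pos hs0 k).2
    have hwl : (0 : ℝ) < wl₀ := by
      have : 0 < wl₀ := by omega
      exact_mod_cast this
    have hwh : (0 : ℝ) < wh₀ := by linarith
    have hinv : 1 / orbitWeight s k * 10 ^ 20 = 10 ^ 40 / (orbitWeight s k * 10 ^ 20) := by
      field_simp
    have hN : (10 : ℝ) ^ 40 = ((10 ^ 40 : ℕ) : ℝ) := by norm_num
    have hM : (10 : ℝ) ^ 20 = ((10 ^ 20 : ℕ) : ℝ) := by norm_num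
    have j1 : 10 ^ 20 ≤ ul := h1 ▸ i1.trans (Nat.le_add_right _ _)
    have j3 : (ul : ℝ) ≤ orbitRatio s (k + 1) * 10 ^ 20 := by
      have e1 : ((10 ^ 40 / wh₀ : ℕ) : ℝ) ≤ 10 ^ 40 / wh₀ := by
        rw [hN]
        exact Nat.cast_div_le
      have e2 : (10 : ℝ) ^ 40 / wh₀ ≤ 10 ^ 40 / (orbitWeight s k * 10 ^ 20) :=
        div_le_div_of_nonneg_left (by positivity) (by positivity) i6
      rw [← h1, orbitRatio_succ, add_mul, hinv, Nat.cast_add]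
      linarith
    have j4 : orbitRatio s (k + 1) * 10 ^ 20 ≤ uh := by
      have e1 : (10 : ℝ) ^ 40 / wl₀ ≤ ((10 ^ 40 / wl₀ + 1 : ℕ) : ℝ) := by
        rw [hN]
        exact div_le_natDiv_add_one _ (by omega)
      have e2 : (10 : ℝ) ^ 40 / (orbitWeight s k * 10 ^ 20) ≤ 10 ^ 40 / wl₀ :=
        div_le_div_of_nonneg_left (by positivity) hwl i5
      rw [← h2, orbitRatio_succ, add_mul, hinv, Nat.cast_add]
      linarith
    have hU' := (orbit_pos hs0 (k + 1)).1
    have hprod : orbitWeight s (k + 1) * 10 ^ 20 =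
        (orbitRatio s (k + 1) * 10 ^ 20) * (orbitWeight s k * 10 ^ 20) / 10 ^ 20 := by
      rw [orbitWeight_succ]
      field_simp
    refine ⟨j1, ?_, j3, j4, ?_, ?_, ?_, ?_⟩
    · rw [← h3, Nat.le_div_iff_mul_le (by positivity)]
      exact Nat.mul_le_mul j1 i2
    · have e1 : ((ul * wl₀ / 10 ^ 20 : ℕ) : ℝ) ≤ (ul : ℝ) * wl₀ / 10 ^ 20 := by
        rw [hM, ← Nat.cast_mul]
        exact Nat.cast_div_le
      rw [← h3, hprod]
      refine e1.trans (div_le_div_of_nonneg_right ?_ (by positivity))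
      exact mul_le_mul j3 i5 hwl.le (by positivity)
    · have e1 : (uh : ℝ) * wh₀ / 10 ^ 20 ≤ ((uh * wh₀ / 10 ^ 20 + 1 : ℕ) : ℝ) := by
        rw [hM, ← Nat.cast_mul]
        exact div_le_natDiv_add_one _ (by positivity)
      rw [← h4, hprod]
      refine le_trans (div_le_div_of_nonneg_right ?_ (by positivity)) e1
      exact mul_le_mul j4 i6 (by positivity) ((by positivity : (0:ℝ) ≤ _).trans j4)
    · rw [Finset.sum_range_succ, add_mul, Nat.cast_add]
      linarith
    · rw [Finset.sum_range_succ, add_mul, Nat.cast_add]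
      linarith

theorem exp_one_lower : (2.7182818284590452353 : ℝ) ≤ Real.exp 1 := by
  have := (abs_le.1 Real.exp_one_near_20).1
  norm_num at this ⊢
  linarith

theorem exp_one_upper : Real.exp 1 ≤ (2.7182818284590452354 : ℝ) := by
  have := (abs_le.1 Real.exp_one_near_20).2
  norm_num at this ⊢
  linarith

/-- An upper bound for a logarithm from the Taylor polynomial of `exp f` and a power of `e`. -/
theorem log_le_of_mul_exp_le {V f : ℝ} {k : ℕ} (hV : 0 < V) (hf : 0 ≤ f) (hf1 : f ≤ 1)
    (h : V * (∑ m ∈ Finset.range 18, f ^ m / m.factorial +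
      f ^ 18 * (18 + 1) / (Nat.factorial 18 * 18)) ≤ 2.7182818284590452353 ^ k) :
    Real.log V ≤ k - f := by
  have h1 := Real.exp_bound' hf hf1 (n := 18) (by norm_num)
  have h2 : V * Real.exp f ≤ Real.exp 1 ^ k := by
    refine ((mul_le_mul_of_nonneg_left ?_ hV.le).trans h).trans
      (pow_le_pow_left₀ (by norm_num) exp_one_lower k)
    exact_mod_cast h1
  rw [← Real.exp_nat_mul, mul_one] at h2
  rw [Real.log_le_iff_le_exp hV, Real.exp_sub, le_div_iff₀ (Real.exp_pos f)]
  exact h2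

/-- A lower bound for a logarithm from the Taylor polynomial of `exp f` and a power of `e`. -/
theorem le_log_of_le_mul_exp {V f : ℝ} {k : ℕ} (hV : 0 < V) (hf : 0 ≤ f)
    (h : 2.7182818284590452354 ^ k ≤ V * ∑ m ∈ Finset.range 18, f ^ m / m.factorial) :
    k - f ≤ Real.log V := by
  have h1 := Real.sum_le_exp_of_nonneg hf 18
  have h2 : Real.exp 1 ^ k ≤ V * Real.exp f :=
    ((pow_le_pow_left₀ (Real.exp_pos 1).le exp_one_upper k).trans h).trans
      (mul_le_mul_of_nonneg_left h1 hV.le)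
  rw [← Real.exp_nat_mul, mul_one] at h2
  rw [Real.le_log_iff_exp_le hV, Real.exp_sub, div_le_iff₀ (Real.exp_pos f)]
  exact h2

theorem enclosure_lower : enclosure 174208428415510000000 174208428415510000000 35 =
    (271828182845901093128, 271828182845901093164, 214649235054822918584856817945310699,
      214649235054822919109750818452376396, 9351570685289755601446, 9351570685289755602073) := by
  decide +kernel

theorem enclosure_upper : enclosure 174208428415530000000 174208428415530000000 35 =
    (271828182845906777184, 271828182845906777222, 214649235055017818963989810513959110,
      214649235055017819538699225052265169, 9351570685289982420012, 9351570685289982420700) := by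
  decide +kernel

theorem enclosure_between : enclosure 174208428415510000000 174208428415530000000 16 =
    (271828169691640703265, 271828169691679718281, 1202636003354128137460487017,
      1202636003356951314643191379, 4186835232027110084035, 4186835232027690168196) := by
  decide +kernel

/-- A chain of `36` steps which is nearly optimal. -/
theorem exists_chainGain_lower :
    ∃ u : ℕ → ℝ, (∀ k, 0 ≤ u k) ∧ (1.70465603718 : ℝ) ≤ chainGain u 36 := by
  obtain ⟨u, hu, hgain⟩ := exists_chain_of_orbit (s := 1.7420842841551) (by norm_num) 35
  refine ⟨u, hu, ?_⟩
  obtain ⟨-, -, -, -, h1, -, -, h2⟩ := enclosure_sound (s := 1.7420842841551)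
    (by norm_num) (by norm_num) (by norm_num) enclosure_lower
  have hV : (2146492350548229.18584 : ℝ) ≤ orbitWeight 1.7420842841551 35 := by
    norm_num at h1 ⊢
    linarith
  have h3 : ((36 : ℕ) : ℝ) - 0.69738856009909 ≤ Real.log 2146492350548229.18584 := by
    refine le_log_of_le_mul_exp (by norm_num) (by norm_num) ?_
    norm_num [Finset.sum_range_succ, Nat.factorial]
  have h4 := h3.trans (Real.log_le_log (by norm_num) hV)
  have h5 : (0 : ℝ) ≤ ((36 : ℕ) : ℝ) - 0.69738856009909 := by norm_num
  have h6 := mul_le_mul exp_one_lower h4 h5 (Real.exp_pos 1).le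
  rw [hgain]
  norm_num at h2 h6 ⊢
  linarith

/-! ### Location of the optimal parameter -/

theorem exp_one_mul_log_le_tangent {x c : ℝ} (hx : 0 < x) (hc : 0 < c) :
    Real.exp 1 * Real.log x ≤ Real.exp 1 * Real.log c + Real.exp 1 * ((x - c) / c) := by
  have h1 := Real.log_le_sub_one_of_pos (div_pos hx hc)
  rw [Real.log_div hx.ne' hc.ne'] at h1
  have h2 : x / c - 1 = (x - c) / c := by field_simp
  rw [h2] at h1
  nlinarith [Real.exp_pos 1]

/-- `x ↦ e log x - x` increases up to `e`. -/
theorem exp_one_mul_log_sub_le {x c : ℝ} (hx : 0 < x) (hxc : x ≤ c) (hc : c ≤ 2.71) :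
    Real.exp 1 * Real.log x - x ≤ Real.exp 1 * Real.log c - c := by
  have hc0 : 0 < c := hx.trans_le hxc
  have h1 := exp_one_mul_log_le_tangent hx hc0
  have h2 := exp_one_lower
  have h3 : Real.exp 1 * ((x - c) / c) = Real.exp 1 / c * (x - c) := by field_simp
  have h4 : 1 ≤ Real.exp 1 / c := by
    rw [le_div_iff₀ hc0]
    linarith
  nlinarith

theorem orbitRatio_one (s : ℝ) : orbitRatio s 1 = s + 1 / s := rfl

theorem orbitWeight_one {s : ℝ} (hs : 0 < s) : orbitWeight s 1 = 1 + s ^ 2 := by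
  rw [orbitWeight_succ' hs, orbitRatio_zero, orbitWeight_zero, pow_two]

theorem orbitRatio_two {s : ℝ} (hs : 0 < s) :
    orbitRatio s 2 = (s ^ 4 + 2 * s ^ 2 + s + 1) / (s * (1 + s ^ 2)) := by
  rw [orbitRatio_succ, orbitWeight_one hs, orbitRatio_one]
  field_simp
  ring

/-- For `s ∈ [1, b]` the function `e log (1 + s²) - 3 s - 1 / s` is largest at `s = b`; up to a
constant it is the contribution of the first three steps to the gain. -/
theorem first_steps_le {s b c : ℝ} (hs : 1 ≤ s) (hsb : s ≤ b) (hb : b ≤ 1.23)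
    (hc : c = 1 + b ^ 2) : Real.exp 1 * Real.log (1 + s ^ 2) - 3 * s - 1 / s ≤
      Real.exp 1 * Real.log c - 3 * b - 1 / b := by
  have hs0 : 0 < s := by linarith
  have hb0 : 0 < b := by linarith
  have hc0 : 0 < c := by rw [hc]; positivity
  have h1 := exp_one_mul_log_le_tangent (show 0 < 1 + s ^ 2 by positivity) hc0
  have h2 := exp_one_lower
  have h3 : Real.exp 1 * ((1 + s ^ 2 - c) / c) = -(Real.exp 1 * (b + s) / c * (b - s)) := by
    rw [hc]
    field_simp
    ring
  have h4 : 1 / s - 1 / b = 1 / (s * b) * (b - s) := by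
    field_simp
  -- the slope `e (b + s) / (1 + b²) + 1 / (s b)` is at least `3`
  have h5 : 3 ≤ Real.exp 1 * (b + s) / c + 1 / (s * b) := by
    have h6 : 2.38 ≤ Real.exp 1 * (b + s) / c := by
      rw [le_div_iff₀ hc0, hc]
      have : 2.718 * (b + s) ≤ Real.exp 1 * (b + s) :=
        mul_le_mul_of_nonneg_right (by linarith) (by linarith)
      nlinarith
    have h7 : 0.66 ≤ 1 / (s * b) := by
      rw [le_div_iff₀ (by positivity)]
      nlinarith
    linarith
  have h8 := mul_le_mul_of_nonneg_right h5 (sub_nonneg.2 hsb)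
  linarith

/-- For small `s` the gain of a stationary chain that satisfies the terminal condition would be too
small; only the first few ratios are needed to see this. -/
theorem gain_lt_of_le {s : ℝ} (hs : 1 ≤ s) (hs' : s ≤ 1.23) :
    Real.exp 1 + 1 - s + orbitGain s 3 < 1.704 := by
  have hs0 : 0 < s := by linarith
  have he := exp_one_upper
  have hepos := Real.exp_pos 1
  have hU2 := (orbit_pos hs0 2).1
  have hU3 := (orbit_pos hs0 3).1
  have hlog : ∀ {c q : ℝ}, Real.log c ≤ q → Real.exp 1 * Real.log c ≤ Real.exp 1 * q :=
    fun h => mul_le_mul_of_nonneg_left h hepos.le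
  have hden : 0 < s * (1 + s ^ 2) := by positivity
  rcases le_total s 1.2 with h | h
  · have h1 : orbitRatio s 2 ≤ 2.5 := by
      rw [orbitRatio_two hs0, div_le_iff₀ hden]
      nlinarith [mul_nonneg (sub_nonneg.2 hs) (sub_nonneg.2 h),
        mul_nonneg (mul_nonneg (sub_nonneg.2 hs) (sub_nonneg.2 h)) hs0.le,
        mul_nonneg (mul_nonneg (sub_nonneg.2 hs) (sub_nonneg.2 h)) (sq_nonneg s)]
    have h2 := exp_one_mul_log_sub_le hU2 h1 (by norm_num)
    have h3 := first_steps_le hs h (by norm_num) rfl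
    have h4 : Real.log (1 + 1.2 ^ 2) ≤ ((1 : ℕ) : ℝ) - 0.108 :=
      log_le_of_mul_exp_le (by norm_num) (by norm_num) (by norm_num)
        (by norm_num [Finset.sum_range_succ, Nat.factorial])
    have h5 : Real.log 2.5 ≤ ((1 : ℕ) : ℝ) - 0.0837 :=
      log_le_of_mul_exp_le (by norm_num) (by norm_num) (by norm_num)
        (by norm_num [Finset.sum_range_succ, Nat.factorial])
    have h6 := orbitGain_antitone hs0 (show 2 ≤ 3 by norm_num)
    have h7 : orbitGain s 2 = (Real.exp 1 * Real.log (orbitRatio s 2) - orbitRatio s 2) +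
        (Real.exp 1 * Real.log (1 + s ^ 2) - 2 * s - 1 / s) := by
      rw [orbitGain, orbitWeight_succ, orbitWeight_one hs0,
        Real.log_mul hU2.ne' (by positivity)]
      simp only [Finset.sum_range_succ, Finset.sum_range_zero, orbitRatio_zero, orbitRatio_one]
      ring
    have h8 := hlog h4
    have h9 := hlog h5
    norm_num at h2 h3 h7 h8 h9 ⊢
    linarith
  · have h1 : orbitRatio s 2 ≤ 2.444 := by
      rw [orbitRatio_two hs0, div_le_iff₀ hden]
      nlinarith [mul_nonneg (sub_nonneg.2 h) (sub_nonneg.2 hs'),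
        mul_nonneg (mul_nonneg (sub_nonneg.2 h) (sub_nonneg.2 hs')) hs0.le,
        mul_nonneg (mul_nonneg (sub_nonneg.2 h) (sub_nonneg.2 hs')) (sq_nonneg s)]
    have h1' : orbitRatio s 3 ≤ 2.612 := by
      have hV1 : 2.44 ≤ orbitWeight s 1 := by
        rw [orbitWeight_one hs0]
        nlinarith
      have hU1 : 2.033 ≤ orbitRatio s 1 := by
        have h3 : s + 1 / s = (s ^ 2 + 1) / s := by field_simp
        rw [orbitRatio_one, h3, le_div_iff₀ hs0]
        nlinarith
      have hV2 : 5.96 ≤ orbitWeight s 2 := by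
        rw [orbitWeight_succ' hs0]
        nlinarith
      have h3 : 1 / orbitWeight s 2 ≤ 1 / 5.96 :=
        one_div_le_one_div_of_le (by norm_num) hV2
      rw [orbitRatio_succ]
      norm_num at h1 h3 ⊢
      linarith
    have h2 := exp_one_mul_log_sub_le hU2 h1 (by norm_num)
    have h2' := exp_one_mul_log_sub_le hU3 h1' (by norm_num)
    have h3 := first_steps_le hs hs' le_rfl rfl
    have h4 : Real.log (1 + 1.23 ^ 2) ≤ ((1 : ℕ) : ℝ) - 0.07856 :=
      log_le_of_mul_exp_le (by norm_num) (by norm_num) (by norm_num)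
        (by norm_num [Finset.sum_range_succ, Nat.factorial])
    have h5 : Real.log 2.444 ≤ ((1 : ℕ) : ℝ) - 0.10636 :=
      log_le_of_mul_exp_le (by norm_num) (by norm_num) (by norm_num)
        (by norm_num [Finset.sum_range_succ, Nat.factorial])
    have h5' : Real.log 2.612 ≤ ((1 : ℕ) : ℝ) - 0.03988 :=
      log_le_of_mul_exp_le (by norm_num) (by norm_num) (by norm_num)
        (by norm_num [Finset.sum_range_succ, Nat.factorial])
    have h7 : orbitGain s 3 = (Real.exp 1 * Real.log (orbitRatio s 3) - orbitRatio s 3) +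
        (Real.exp 1 * Real.log (orbitRatio s 2) - orbitRatio s 2) +
        (Real.exp 1 * Real.log (1 + s ^ 2) - 2 * s - 1 / s) := by
      rw [orbitGain, orbitWeight_succ, orbitWeight_succ, orbitWeight_one hs0,
        Real.log_mul hU3.ne' (by positivity), Real.log_mul hU2.ne' (by positivity)]
      simp only [Finset.sum_range_succ, Finset.sum_range_zero, orbitRatio_zero, orbitRatio_one]
      ring
    have h8 := hlog h4
    have h9 := hlog h5
    have h9' := hlog h5'
    norm_num at h2 h2' h3 h7 h8 h9 h9' ⊢
    linarith

theorem orbitRatio_lt_of_mem {s : ℝ} (hs : 1.23 ≤ s) (hs' : s ≤ 1.7) (m : ℕ) :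
    orbitRatio s (m + 1) < Real.exp 1 := by
  have hs0 : 0 < s := by linarith
  have he := exp_one_lower
  have hden : 0 < s * (1 + s ^ 2) := by positivity
  -- `θ ≤ U_2` bounds the ratios after `U_1` from below
  have key : ∀ θ c : ℝ, 1 < θ → θ / (θ - 1) = c → θ ≤ orbitRatio s 2 →
      (s ^ 2 + 1) ^ 2 + c * s < 2.718 * (s * (1 + s ^ 2)) →
      orbitRatio s (m + 1) < Real.exp 1 := by
    intro θ c hθ hc h2 hpoly
    have h1 := orbitRatio_add_le hs0 hθ (k := 1) h2 m
    rw [hc, orbitWeight_one hs0, orbitRatio_one, add_comm 1 m] at h1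
    have h3 : s + 1 / s + c / (1 + s ^ 2) = ((s ^ 2 + 1) ^ 2 + c * s) / (s * (1 + s ^ 2)) := by
      field_simp
      ring
    rw [h3] at h1
    have h4 := (div_lt_iff₀ hden).2 hpoly
    linarith
  rcases le_total s 1.6 with h | h
  · refine key 2.4395 (2.4395 / 1.4395) (by norm_num) (by norm_num) ?_ ?_
    · rw [orbitRatio_two hs0, le_div_iff₀ hden]
      nlinarith [sq_nonneg (s - 1.265), mul_nonneg hs0.le (sq_nonneg (s - 1.265)),
        mul_nonneg (sq_nonneg s) (sq_nonneg (s - 1.265))]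
    · have hp := mul_nonneg (sub_nonneg.2 hs) (sub_nonneg.2 h)
      nlinarith [hp, mul_nonneg hp hs0.le, mul_nonneg hp (sq_nonneg s)]
  · have hp := mul_nonneg (sub_nonneg.2 h) (sub_nonneg.2 hs')
    refine key 2.5 (5 / 3) (by norm_num) (by norm_num) ?_ ?_
    · rw [orbitRatio_two hs0, le_div_iff₀ hden]
      nlinarith [hp, mul_nonneg hp hs0.le, mul_nonneg hp (sq_nonneg s)]
    · nlinarith [hp, mul_nonneg hp hs0.le, mul_nonneg hp (sq_nonneg s)]

/-- The parameter of a long maximal chain, up to `2 · 10⁻¹³`. -/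
theorem IsMaxChain.mem_interval {u : ℕ → ℝ} {m : ℕ} (h : IsMaxChain u (m + 2)) (hm : 34 ≤ m) :
    1.7420842841551 ≤ 1 + u 0 ∧ 1 + u 0 ≤ 1.7420842841553 := by
  have hs1 : 1 ≤ 1 + u 0 := by linarith [h.1 0]
  have hs0 : 0 < 1 + u 0 := by linarith
  have hend := h.orbitRatio_eq
  have hgain := h.gain_eq
  set s := 1 + u 0 with hs
  have hlow : 1.23 < s := by
    by_contra! hle
    obtain ⟨v, hv, hv'⟩ := exists_chainGain_lower
    obtain ⟨w, hw, hw'⟩ := exists_chainGain_ge hv (show 36 ≤ m + 2 by omega)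
    have h1 := h.2 w hw
    have h2 := gain_lt_of_le hs1 hle
    have h3 := orbitGain_antitone hs0 (show 3 ≤ m by omega)
    linarith
  have hmid : 1.7 ≤ s := by
    by_contra! hlt
    exact (orbitRatio_lt_of_mem hlow.le hlt.le m).ne hend
  constructor
  · by_contra! hlt
    have h1 := orbitRatio_mono hmid hlt.le (m + 1)
    obtain ⟨-, -, -, h2, h3, -, -, -⟩ := enclosure_sound (s := 1.7420842841551)
      (by norm_num) (by norm_num) (by norm_num) enclosure_lower
    have hs0' : (0 : ℝ) < 1.7420842841551 := by norm_num
    have h4 := orbitRatio_add_le hs0' one_lt_two (k := 35)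
      (two_le_orbitRatio hs0' (by norm_num)) (m + 1 - 35)
    rw [show 35 + (m + 1 - 35) = m + 1 by omega] at h4
    have h5 : 2 / (2 - 1) / orbitWeight 1.7420842841551 35 ≤ 1e-15 := by
      rw [div_le_iff₀ (orbit_pos hs0' 35).2]
      norm_num at h3 ⊢
      linarith
    have h6 := exp_one_lower
    norm_num at h2 h4 h5 h6 h1
    linarith
  · by_contra! hlt
    have h1 := orbitRatio_mono (by norm_num) hlt.le (m + 1)
    obtain ⟨-, -, h2, -, -, -, -, -⟩ := enclosure_sound (s := 1.7420842841553)
      (by norm_num) (by norm_num) (by norm_num) enclosure_upper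
    have h3 := orbitRatio_monotone (s := 1.7420842841553) (by norm_num)
      (show 35 ≤ m + 1 by omega)
    have h6 := exp_one_upper
    norm_num at h2 h3 h6 h1
    linarith

theorem IsMaxChain.gain_upper {u : ℕ → ℝ} {m : ℕ} (h : IsMaxChain u (m + 2)) (hm : 34 ≤ m) :
    chainGain u (m + 2) ≤ 1.704656037189 := by
  obtain ⟨hl, hr⟩ := h.mem_interval hm
  rw [h.gain_eq]
  set s := 1 + u 0 with hs
  have hs0 : 0 < s := by linarith
  have h1 := orbitGain_antitone hs0 (show 16 ≤ m by omega)
  obtain ⟨-, -, h2, -, -, h3, h4, -⟩ := enclosure_sound (s := s)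
    (by norm_num) (by norm_num; linarith) (by norm_num; linarith) enclosure_between
  have hV := (orbit_pos hs0 16).2
  have h5 : orbitWeight s 16 ≤ 12026360.03356951314644 := by
    norm_num at h3 ⊢
    linarith
  have h6 : Real.log 12026360.03356951314644 ≤ ((17 : ℕ) : ℝ) - 0.69738853193453 :=
    log_le_of_mul_exp_le (by norm_num) (by norm_num) (by norm_num)
      (by norm_num [Finset.sum_range_succ, Nat.factorial])
  have h7 := mul_le_mul_of_nonneg_left ((Real.log_le_log hV h5).trans h6) (Real.exp_pos 1).le
  have h8 := exp_one_upper
  have h9 : orbitGain s 16 = Real.exp 1 * Real.log (orbitWeight s 16) -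
      (∑ k ∈ Finset.range 16, orbitRatio s k + orbitRatio s 16) := by
    rw [orbitGain, Finset.sum_range_succ]
  norm_num at h2 h4 h7 ⊢
  linarith

/-! ### The constant and the asymptotic formula -/

/-- The supremum of the gains of all chains with nonnegative steps; this is the constant `A`. -/
noncomputable def gainSup : ℝ :=
  sSup {a : ℝ | ∃ (m : ℕ) (u : ℕ → ℝ), (∀ k, 0 ≤ u k) ∧ a = chainGain u m}

theorem IsMaxChain.gainSup_le {u : ℕ → ℝ} {K : ℕ} (h : IsMaxChain u (K + 1)) :
    gainSup ≤ chainGain u (K + 1) + 2 / 2 ^ K := by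
  refine csSup_le ⟨_, 0, fun _ => 0, fun _ => le_rfl, rfl⟩ ?_
  rintro a ⟨m, v, hv, rfl⟩
  exact h.gain_le hv m

theorem chainGain_le_gainSup {u : ℕ → ℝ} (hu : ∀ k, 0 ≤ u k) (m : ℕ) :
    chainGain u m ≤ gainSup := by
  obtain ⟨w, hw⟩ : ∃ w, IsMaxChain w (0 + 1) := exists_chainGain_max _
  refine le_csSup ⟨chainGain w (0 + 1) + 2 / 2 ^ 0, ?_⟩ ⟨m, u, hu, rfl⟩
  rintro a ⟨m, v, hv, rfl⟩
  exact hw.gain_le hv m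

theorem gainSup_lower : 1.70465603718 ≤ gainSup := by
  obtain ⟨u, hu, h⟩ := exists_chainGain_lower
  exact h.trans (chainGain_le_gainSup hu _)

theorem gainSup_upper : gainSup < 1.70465603719 := by
  obtain ⟨w, hw⟩ : ∃ w, IsMaxChain w (58 + 2) := exists_chainGain_max _
  have h1 := hw.gain_upper (by norm_num)
  have h2 := IsMaxChain.gainSup_le (K := 59) hw
  have h3 : (2 : ℝ) / 2 ^ 59 < 1e-13 := by norm_num
  norm_num at h1 h2 h3 ⊢
  linarith

theorem IsMaxChain.weight_le {u : ℕ → ℝ} {m : ℕ} (h : IsMaxChain u (m + 2)) :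
    chainWeight u (m + 2) ≤ Real.exp 1 ^ (m + 2) := by
  have hs : 0 < 1 + u 0 := by linarith [h.1 0]
  have key : ∀ k ≤ m, chainWeight u (k + 1) ≤ Real.exp 1 ^ (k + 1) := by
    intro k
    induction k with
    | zero =>
      intro _
      have h1 := orbitRatio_monotone hs (Nat.zero_le (m + 1))
      rw [h.orbitRatio_eq, orbitRatio_zero] at h1
      simpa [chainWeight] using h1
    | succ k ih =>
      intro hk
      have h1 := orbitRatio_monotone hs (show k + 1 ≤ m + 1 by omega)
      rw [h.orbitRatio_eq] at h1
      rw [h.weight_succ (show k + 1 + 1 < m + 2 by omega), (h.eq_orbit hk).1, pow_succ']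
      exact mul_le_mul h1 (ih (by omega)) (chainWeight_pos h.1 _).le (Real.exp_pos 1).le
  rw [h.weight_last, pow_succ']
  exact mul_le_mul_of_nonneg_left (key m le_rfl) (Real.exp_pos 1).le

/-- A chain continued by `k` equal steps `θ`. -/
theorem exists_extension {u : ℕ → ℝ} {M : ℕ} (hpos : ∀ k < M, 0 < u k)
    {θ : ℝ} (hθ : 0 < θ) (k : ℕ) :
    ∃ v : ℕ → ℝ, (∀ i, 0 < v i) ∧
      ∑ i ∈ Finset.range (M + k), v i = ∑ i ∈ Finset.range M, u i + k * θ ∧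
      θ ^ k * chainWeight u M ≤ chainWeight v (M + k) := by
  set v : ℕ → ℝ := fun i => if i < M then u i else θ with hv
  have hvpos : ∀ i, 0 < v i := by
    intro i
    simp only [hv]
    split_ifs with hi
    · exact hpos i hi
    · exact hθ
  refine ⟨v, hvpos, ?_, ?_⟩
  · rw [Finset.sum_range_add]
    congr 1
    · exact Finset.sum_congr rfl fun i hi => if_pos (Finset.mem_range.1 hi)
    · rw [Finset.sum_congr rfl fun i _ => (if_neg (by omega) : v (M + i) = θ)]
      simp
  · induction k with
    | zero =>
      rw [chainWeight_congr (u := u) (v := v) fun i hi => (if_pos hi).symm]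
      simp
    | succ k ih =>
      rw [← add_assoc, chainWeight, show v (M + k) = θ from if_neg (by omega), pow_succ']
      have := mul_le_mul_of_nonneg_left ih hθ.le
      linarith

/-- A maximal chain with about `(log n) / 4` steps, extended by equal steps close to `e` until its
weight is `n / e`. -/
theorem lowerBound_le_log {n : ℕ} (hL : 12 ≤ Real.log n) :
    lowerBound n ≤ Real.exp 1 * Real.log n - gainSup + 16 / Real.log n := by
  set L := Real.log n with hLdef
  have hL0 : 0 < L := by linarith
  have hn : (0 : ℝ) < n := by
    rcases Nat.eq_zero_or_pos n with rfl | h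
    · simp [hLdef] at hL0
    · exact_mod_cast h
  set m := ⌊L / 4⌋₊ with hm
  have hm1 : (m : ℝ) ≤ L / 4 := Nat.floor_le (by linarith)
  have hm2 : L / 4 < m + 1 := Nat.lt_floor_add_one _
  obtain ⟨u, hu⟩ : ∃ u, IsMaxChain u (m + 2) := exists_chainGain_max _
  have hW := chainWeight_pos hu.1 (m + 2)
  set W := chainWeight u (m + 2) with hWdef
  have hlogW : Real.log W ≤ L / 4 + 2 := by
    have h1 := Real.log_le_log hW hu.weight_le
    rw [Real.log_pow, Real.log_exp, mul_one] at h1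
    push_cast at h1
    linarith
  have hgain := IsMaxChain.gainSup_le (K := m + 1) hu
  have hpow : (2 : ℝ) / 2 ^ (m + 1) ≤ 4 / L := by
    have h1 : (m : ℝ) + 1 ≤ 2 ^ m := by
      exact_mod_cast Nat.lt_two_pow_self (n := m)
    rw [div_le_div_iff₀ (by positivity) hL0, pow_succ]
    linarith
  -- `n / (e W) = exp y`, and the `k` additional steps are `exp (y / k)`
  set y := L - 1 - Real.log W with hy
  have hy0 : L / 2 ≤ y := by linarith
  set k := ⌊y⌋₊ with hk
  have hk1 : (k : ℝ) ≤ y := Nat.floor_le (by linarith)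
  have hk2 : y < k + 1 := Nat.lt_floor_add_one _
  have hk3 : L / 4 ≤ k := by linarith
  have hkpos : (0 : ℝ) < k := by linarith
  set δ := y / k - 1 with hδ
  have hδk : k * (1 + δ) = y := by
    rw [hδ]
    field_simp
    ring
  have hδ0 : 0 ≤ δ := by
    rw [hδ, sub_nonneg, one_le_div hkpos]
    exact hk1
  have hδ1 : δ * k ≤ 1 := by linarith
  have hδ2 : δ ≤ 1 := by nlinarith
  obtain ⟨v, hv, hsum, hweight⟩ := exists_extension (M := m + 2) (fun j hj => hu.pos hj)
    (Real.exp_pos (1 + δ)) k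
  have hWv := chainWeight_pos (fun i => (hv i).le) (m + 2 + k)
  have hnW : Real.exp (1 + δ) ^ k * W = n / Real.exp 1 := by
    rw [← Real.exp_nat_mul, hδk, hy, Real.exp_sub, Real.exp_sub, Real.exp_log hW, hLdef,
      Real.exp_log hn]
    field_simp
  have hlast : n / chainWeight v (m + 2 + k) ≤ Real.exp 1 := by
    rw [div_le_iff₀ hWv]
    have h1 : n / Real.exp 1 ≤ chainWeight v (m + 2 + k) := hnW ▸ hweight
    rw [div_le_iff₀ (Real.exp_pos 1)] at h1
    linarith
  have hlen : m + 2 + k < n := by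
    have h1 := Real.quadratic_le_exp_of_nonneg hL0.le
    rw [hLdef, Real.exp_log hn, ← hLdef] at h1
    have hW1 : 0 ≤ Real.log W := Real.log_nonneg (one_le_chainWeight hu.1 _)
    have h2 : ((m + 2 + k : ℕ) : ℝ) < n := by
      push_cast
      nlinarith
    exact_mod_cast h2
  have hmain := lowerBound_le_chain hlen hv
  rw [hsum] at hmain
  have hexp : k * Real.exp (1 + δ) ≤ Real.exp 1 * y + 12 / L := by
    have h1 : Real.exp δ ≤ 1 + δ + δ ^ 2 := by
      have h := Real.abs_exp_sub_one_sub_id_le (x := δ) (by rwa [abs_of_nonneg hδ0])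
      linarith [(abs_le.1 h).2]
    have h2 : k * δ ^ 2 ≤ 4 / L := by
      rw [le_div_iff₀ hL0]
      have h3 : k * δ ^ 2 * L ≤ k * δ ^ 2 * (4 * k) :=
        mul_le_mul_of_nonneg_left (by linarith) (by positivity)
      nlinarith
    have h3 : k * Real.exp δ ≤ y + 4 / L := by
      have := mul_le_mul_of_nonneg_left h1 hkpos.le
      linarith
    have h4 := mul_le_mul_of_nonneg_left h3 (Real.exp_pos 1).le
    have h5 : Real.exp 1 * (4 / L) ≤ 3 * (4 / L) :=
      mul_le_mul_of_nonneg_right Real.exp_one_lt_three.le (by positivity)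
    have h6 : (12 : ℝ) / L = 3 * (4 / L) := by ring
    rw [Real.exp_add]
    linarith
  have hg : chainGain u (m + 2) =
      Real.exp 1 * Real.log W - ∑ i ∈ Finset.range (m + 2), u i := rfl
  have h16 : (16 : ℝ) / L = 12 / L + 4 / L := by ring
  have hye : Real.exp 1 * y = Real.exp 1 * L - Real.exp 1 - Real.exp 1 * Real.log W := by
    rw [hy]
    ring
  linarith

end CyclicSum

theorem theorem1 :
    ∃ A : ℝ, (1.70465603718 : ℝ) ≤ A ∧ A < (1.70465603719 : ℝ) ∧
      (fun n : ℕ => CyclicSum.lowerBound n - (Real.exp 1 * Real.log (n : ℝ) - A))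
        =O[atTop] (fun n : ℕ => 1 / Real.log (n : ℝ)) := by
  refine ⟨CyclicSum.gainSup, CyclicSum.gainSup_lower, CyclicSum.gainSup_upper,
    IsBigO.of_bound 16 ?_⟩
  have hlog : Tendsto (fun n : ℕ => Real.log n) atTop atTop :=
    Real.tendsto_log_atTop.comp tendsto_natCast_atTop_atTop
  filter_upwards [hlog.eventually_ge_atTop 12, eventually_gt_atTop 0] with n hn hn0
  have h1 := CyclicSum.le_lowerBound_of_gain_le
    (fun m u hu => CyclicSum.chainGain_le_gainSup hu m) hn0
  have h2 := CyclicSum.lowerBound_le_log hn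
  have hL : 0 < Real.log n := by linarith
  rw [Real.norm_of_nonneg (by linarith), Real.norm_of_nonneg (by positivity), mul_one_div]
  linarith
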